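/- **Setting.** Let $N\ge 0$, let $H_S$ be a Hermitian $N\times N$ matrix, $\omega:\mathbb R\to\mathbb R$ measurable and $g\in L^2(\mathbb R)$ (complex valued). On $\mathcal H=(\mathbb C\oplus\mathbb C^N)\otimes\bigotimes_{i=1}^N\mathfrak F_b(L^2(\mathbb R))$, with orthonormal basis $|0\rangle,|1\rangle,\dots,|N\rangle$ of $\mathbb C\oplus\mathbb C^N$, vacuum $|\Omega\rangle$ and bosonic annihilation operators $b_{k,i}$, consider $$\hat H_0=(0\oplus H_S)\otimes I+I\otimes\sum_{i}\int\omega(k)\,b_{k,i}^\dagger b_{k,i}\,dk,\qquad \hat H=\hat H_0+\sum_i\int\bigl(g_k^*\,|0\rangle\langle i|\otimes b_{k,i}^\dagger+g_k\,|i\rangle\langle 0|\otimes b_{k,i}\bigr)dk,$$ and the unitary groups $e^{-i\hat H_0t}$, $e^{-i\hat Ht}$ they generate. Let $U_{t_1}^{t_2}=e^{i\hat H_0t_2}e^{-i\hat H(t_2-t_1)}e^{-i\hat H_0t_1}$ be the propagator in the interaction picture and $\mathcal U_{t_1}^{t_2}(T)=U_{t_1}^{t_2}\,T\,(U_{t_1}^{t_2})^\dagger$.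 For a density matrix $\rho_S(0)$ of the system put $\rho_{SI}(t)=\operatorname{Tr}_B\,\mathcal U_0^t(\rho_S(0)\otimes|\Omega\rangle\langle\Omega|)$, and let $\Phi_{t_1}^{t_2}$ ($t_2\ge t_1\ge 0$) be the linear superoperator with $\rho_{SI}(t_2)=\Phi_{t_1}^{t_2}(\rho_{SI}(t_1))$ for all $\rho_S(0)$. Let $G(t)=\int|g_k|^2e^{-i\omega(k)t}dk$ and let $V(t)$, $t\ge0$, be the $N\times N$ matrix solution of $$\frac{d}{dt}V(t)=-\int_0^tG(t-s)\,e^{iH_S(t-s)}\,V(s)\,ds,\qquad V(0)=I.$$ For $h\in\mathbb C^N$ let $\sigma_h=\begin{pmatrix}0&0\\h&0\end{pmatrix}$ be the dipole operator, and for $t_2\ge t_1\ge0$ define $$\langle\sigma_{h_2}^\dagger(t_2)\sigma_{h_1}(t_1)\rangle_M=\operatorname{Tr}\,\sigma_{h_2}^\dagger\,\Phi_{t_1}^{t_2}\bigl(\sigma_{h_1}\Phi_0^{t_1}(|0\rangle\langle0|)\bigr),$$ $$\langle\sigma_{h_2}^\dagger(t_2)\sigma_{h_1}(t_1)\rangle=\operatorname{Tr}\,(\sigma_{h_2}^\dagger\otimes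 I)\,\mathcal U_{t_1}^{t_2}\bigl((\sigma_{h_1}\otimes I)\,\mathcal U_0^{t_1}(|0\rangle\langle0|\otimes|\Omega\rangle\langle\Omega|)\bigr).$$ **Theorem.** Let $t_2\ge t_1\ge0$ and $h_1,h_2\in\mathbb C^N$. 1. If $V(t_1)$ is invertible, then $\langle\sigma_{h_2}^\dagger(t_2)\sigma_{h_1}(t_1)\rangle_M=h_2^+V(t_2)V(t_1)^{-1}h_1$. 2. The operator whose trace defines the exact correlation function is of trace class, and $\langle\sigma_{h_2}^\dagger(t_2)\sigma_{h_1}(t_1)\rangle=h_2^+V(t_2-t_1)h_1$. 3. If $V(t)$ is invertible for every $t\ge0$, then $\langle\sigma_{h_2}^\dagger(t_2)\sigma_{h_1}(t_1)\rangle=\langle\sigma_{h_2}^\dagger(t_2)\sigma_{h_1}(t_1)\rangle_M$ for all $t_2\ge t_1\ge0$ and all $h_1,h_2\in\mathbb C^N$ if and only if $V$ is a semigroup: $V(s+t)=V(s)V(t)$ for all $s,t\ge0$. -/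

import Mathlib

open MeasureTheory Matrix
open scoped ComplexConjugate ComplexOrder

noncomputable section

namespace RWA

/-! ### Unitary groups, traces (on an arbitrary Hilbert space) -/

section Abstract

variable {E : Type} [NormedAddCommGroup E] [InnerProductSpace ℂ E]

/-- `U t = e^{-i t A}`: `U` is a strongly continuous one-parameter unitary group whose generator
extends the (unbounded) operator `A`, given by its graph: `A x y` means that `x` is in the domain
of `A` and `A x = y`. If `A` is essentially self-adjoint, there is exactly one such group, and its
generator is the closure of `A`. -/
structure IsUnitaryGroup (A : E → E → Prop) (U : ℝ → E ≃ₗᵢ[ℂ] E) : Prop where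
  map_add : ∀ (s t : ℝ) (x : E), U (s + t) x = U s (U t x)
  continuous : ∀ x : E, Continuous fun t : ℝ => U t x
  generator : ∀ x y : E, A x y → HasDerivAt (fun t : ℝ => U t x) (-Complex.I • y) 0

/-- `T` is a trace-class operator with trace `τ`: in every orthonormal basis the diagonal matrix
elements of `T` are (unconditionally) summable with sum `τ`. -/
def HasTrace (T : E →L[ℂ] E) (τ : ℂ) : Prop :=
  ∀ (ι : Type) (b : HilbertBasis ι ℂ E), HasSum (fun i => inner ℂ (b i) (T (b i))) τ

open Classical in
/-- The trace of a trace-class operator (and `0` for other operators). -/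
def tr (T : E →L[ℂ] E) : ℂ := if h : ∃ τ, HasTrace T τ then h.choose else 0

/-- A unitary operator acting on operators (states): `T ↦ U T U†`. -/
def conjBy (U : E ≃ₗᵢ[ℂ] E) (T : E →L[ℂ] E) : E →L[ℂ] E :=
  (U.toContinuousLinearEquiv : E →L[ℂ] E) ∘L T ∘L
    (U.symm.toContinuousLinearEquiv : E →L[ℂ] E)

end Abstract

/-! ### The Hilbert space -/

/-- The labels `(i, k)` of the reservoir modes: the reservoir `i` and the mode `k ∈ ℝ`. -/
abbrev Mode (N : ℕ) : Type := Fin N × ℝ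

/-- Counting measure times Lebesgue measure, so that `L²(Mode N) = ⨁ i, L²(ℝ)`. -/
def modeMeasure (N : ℕ) : Measure (Mode N) := (Measure.count : Measure (Fin N)).prod volume

instance (N : ℕ) : SigmaFinite (modeMeasure N) := by
  unfold modeMeasure; infer_instance

/-- The measure on configurations of `n` bosons. -/
abbrev confMeasure (N n : ℕ) : Measure (Fin n → Mode N) := Measure.pi fun _ => modeMeasure N

/-- A permutation of the bosons preserves the measure. -/
theorem measurePreserving_perm (N n : ℕ) (σ : Equiv.Perm (Fin n)) :
    MeasurePreserving (fun x : Fin n → Mode N => fun r => x (σ r))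
      (confMeasure N n) (confMeasure N n) := by
  have h := measurePreserving_piCongrLeft (fun _ : Fin n => modeMeasure N) σ.symm
  convert h using 1
  funext x r
  simp only [MeasurableEquiv.coe_piCongrLeft]
  obtain ⟨r', rfl⟩ := σ.symm.surjective r
  rw [Equiv.piCongrLeft_apply_apply]
  simp

/-- The action of a permutation on `n`-boson wave functions. -/
def permute (N n : ℕ) (σ : Equiv.Perm (Fin n)) :
    Lp ℂ 2 (confMeasure N n) →L[ℂ] Lp ℂ 2 (confMeasure N n) :=
  (Lp.compMeasurePreservingₗᵢ ℂ _ (measurePreserving_perm N n σ)).toContinuousLinearMap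

/-- The `n`-boson space: square integrable wave functions invariant under permutations. -/
def bosonSpace (N n : ℕ) : Submodule ℂ (Lp ℂ 2 (confMeasure N n)) :=
  ⨅ σ : Equiv.Perm (Fin n), LinearMap.ker ((permute N n σ - 1 :
    Lp ℂ 2 (confMeasure N n) →L[ℂ] Lp ℂ 2 (confMeasure N n)) :
    Lp ℂ 2 (confMeasure N n) →ₗ[ℂ] Lp ℂ 2 (confMeasure N n))

instance (N n : ℕ) : CompleteSpace (bosonSpace N n) := by
  have h : IsClosed (bosonSpace N n : Set (Lp ℂ 2 (confMeasure N n))) := by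
    rw [bosonSpace, Submodule.coe_iInf]
    exact isClosed_iInter fun σ => ContinuousLinearMap.isClosed_ker _
  exact h.completeSpace_coe

/-- The Hilbert space of the `N` reservoirs: the bosonic Fock space over `⨁ i, L²(ℝ)`, which is
the tensor product of `N` bosonic Fock spaces over `L²(ℝ)`. -/
abbrev Fock (N : ℕ) : Type := lp (fun n : ℕ => bosonSpace N n) 2

/-- The constant wave function `1` of zero bosons. -/
def zeroBoson (N : ℕ) : bosonSpace N 0 :=
  ⟨indicatorConstLp 2 (μ := confMeasure N 0) MeasurableSet.univ (by simp [confMeasure]) (1 : ℂ), by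
    rw [bosonSpace, Submodule.mem_iInf]
    intro σ
    obtain rfl : σ = 1 := Subsingleton.elim _ _
    rw [LinearMap.mem_ker]
    refine sub_eq_zero.2 (Lp.ext ?_)
    exact Lp.coeFn_compMeasurePreserving _ (measurePreserving_perm N 0 1)⟩

/-- The vacuum `|Ω⟩` of the reservoirs. -/
def vacuum (N : ℕ) : Fock N := lp.single 2 0 (zeroBoson N)

/-- The levels of the system: `Sum.inl ()` is the ground state `|0⟩`, and `Sum.inr i` are the
excited states `|i⟩`. -/
abbrev Level (N : ℕ) : Type := Unit ⊕ Fin N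

/-- The total Hilbert space `(ℂ ⊕ ℂ^N) ⊗ Fock N`, as the orthogonal sum of copies of `Fock N`
labelled by the levels. -/
abbrev Total (N : ℕ) : Type := PiLp 2 fun _ : Level N => Fock N

/-- Operators on the system. -/
abbrev SysOp (N : ℕ) : Type := Matrix (Level N) (Level N) ℂ

/-- The operator `A ⊗ T` on the total Hilbert space. -/
def tensor {N : ℕ} (A : SysOp N) (T : Fock N →L[ℂ] Fock N) : Total N →L[ℂ] Total N :=
  ((PiLp.continuousLinearEquiv 2 ℂ fun _ : Level N => Fock N).symm :
      (Level N → Fock N) →L[ℂ] Total N) ∘L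
    ContinuousLinearMap.pi fun i => ∑ j, A i j • (T ∘L PiLp.proj 2 (fun _ : Level N => Fock N) j)

/-- The block `⟨i| T |j⟩` of an operator on the total space, an operator on `Fock N`. -/
def block {N : ℕ} (T : Total N →L[ℂ] Total N) (i j : Level N) : Fock N →L[ℂ] Fock N :=
  PiLp.proj 2 (fun _ : Level N => Fock N) i ∘L T ∘L
    ((PiLp.continuousLinearEquiv 2 ℂ fun _ : Level N => Fock N).symm :
      (Level N → Fock N) →L[ℂ] Total N) ∘L
    ContinuousLinearMap.single ℂ (fun _ : Level N => Fock N) j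

/-- The partial trace `Tr_B` over the reservoirs. -/
def partialTrace {N : ℕ} (T : Total N →L[ℂ] Total N) : SysOp N :=
  Matrix.of fun i j => tr (block T i j)

/-! ### The Hamiltonians -/

/-- The system Hamiltonian `0 ⊕ H_S`. -/
def sysHam {N : ℕ} (HS : Matrix (Fin N) (Fin N) ℂ) : SysOp N := Matrix.fromBlocks 0 0 0 HS

/-- The wave function of the component of `Ψ` with the system in the level `j` and with
`n` bosons. -/
def wave {N : ℕ} (Ψ : Total N) (j : Level N) (n : ℕ) : (Fin n → Mode N) → ℂ :=
  ((Ψ j n : bosonSpace N n) : Lp ℂ 2 (confMeasure N n))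

/-- `((H_S ⊗ I) Ψ)_{j, n}(x)`. -/
def sysTerm {N : ℕ} (HS : Matrix (Fin N) (Fin N) ℂ) (Ψ : Total N) (j : Level N) (n : ℕ)
    (x : Fin n → Mode N) : ℂ :=
  ∑ l, sysHam HS j l * wave Ψ l n x

/-- `((I ⊗ H_B) Ψ)_{j, n}(x)` for `H_B = ∑ i, ∫ ω(k) b†_{k,i} b_{k,i} dk`, which multiplies the
`n`-boson wave function by the sum of the energies of the bosons. -/
def bathTerm {N : ℕ} (ω : ℝ → ℝ) (Ψ : Total N) (j : Level N) (n : ℕ)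
    (x : Fin n → Mode N) : ℂ :=
  ((∑ r, ω (x r).2 : ℝ) : ℂ) * wave Ψ j n x

/-- `(H_I Ψ)_{j, n}(x)` for
`H_I = ∑ i, ∫ (g_k^* |0⟩⟨i| ⊗ b†_{k,i} + g_k |i⟩⟨0| ⊗ b_{k,i}) dk`, where
`(b_{k,i} ψ)_n(x) = √(n+1) ψ_{n+1}((i,k), x)` and
`(∑ i, ∫ f_i(k) b†_{k,i} ψ dk)_{n+1}(x) = (n+1)^{-1/2} ∑ r, f(x_r) ψ_n(x without x_r)`. -/
def intTerm {N : ℕ} (g : ℝ → ℂ) (Ψ : Total N) :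
    (j : Level N) → (n : ℕ) → (Fin n → Mode N) → ℂ
  | Sum.inl _, 0, _ => 0
  | Sum.inl _, n + 1, x =>
      ((Real.sqrt (n + 1) : ℝ) : ℂ)⁻¹ *
        ∑ r : Fin (n + 1), conj (g (x r).2) * wave Ψ (Sum.inr (x r).1) n (r.removeNth x)
  | Sum.inr i, n, x =>
      ((Real.sqrt (n + 1) : ℝ) : ℂ) *
        ∫ k : ℝ, g k * wave Ψ (Sum.inl ()) (n + 1)
          (Fin.cons (α := fun _ => Mode N) (i, k) x)

/-- Only finitely many boson numbers occur in `Ψ`. -/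
def FinitelyManyBosons {N : ℕ} (Ψ : Total N) : Prop :=
  ∃ M : ℕ, ∀ (j : Level N) (n : ℕ), M ≤ n → wave Ψ j n =ᵐ[confMeasure N n] 0

/-- The graph of the free Hamiltonian `H_S ⊗ I + I ⊗ H_B`, on the vectors with finitely many
bosons that it maps to square integrable functions. -/
def freeHam {N : ℕ} (HS : Matrix (Fin N) (Fin N) ℂ) (ω : ℝ → ℝ) (Ψ Θ : Total N) : Prop :=
  FinitelyManyBosons Ψ ∧ ∀ (j : Level N) (n : ℕ),
    wave Θ j n =ᵐ[confMeasure N n] fun x => sysTerm HS Ψ j n x + bathTerm ω Ψ j n x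

/-- The graph of the full Hamiltonian `H = H_S ⊗ I + I ⊗ H_B + H_I`, on the vectors with finitely
many bosons that it maps to square integrable functions. -/
def fullHam {N : ℕ} (HS : Matrix (Fin N) (Fin N) ℂ) (ω : ℝ → ℝ) (g : ℝ → ℂ)
    (Ψ Θ : Total N) : Prop :=
  FinitelyManyBosons Ψ ∧ ∀ (j : Level N) (n : ℕ),
    wave Θ j n =ᵐ[confMeasure N n]
      fun x => sysTerm HS Ψ j n x + bathTerm ω Ψ j n x + intTerm g Ψ j n x

/-! ### Dynamics. Below `U₀ t = e^{-i (H_S + H_B) t}` and `U t = e^{-i H t}`. -/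

section Dynamics

variable {N : ℕ} (U₀ U : ℝ → Total N ≃ₗᵢ[ℂ] Total N)

/-- The propagator in the interaction picture,
`U_{t₁}^{t₂} = e^{i (H_S + H_B) t₂} e^{-i H (t₂ - t₁)} e^{-i (H_S + H_B) t₁}`. -/
def intProp (t₁ t₂ : ℝ) : Total N ≃ₗᵢ[ℂ] Total N :=
  ((U₀ t₁).trans (U (t₂ - t₁))).trans (U₀ (-t₂))

/-- The dynamics of states in the interaction picture, `𝒰_{t₁}^{t₂}(T) = U T U†`. -/
def stateDyn (t₁ t₂ : ℝ) (T : Total N →L[ℂ] Total N) : Total N →L[ℂ] Total N :=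
  conjBy (intProp U₀ U t₁ t₂) T

/-- The projection `|Ω⟩⟨Ω|`. -/
def vacuumProj (N : ℕ) : Fock N →L[ℂ] Fock N :=
  InnerProductSpace.rankOne ℂ (vacuum N) (vacuum N)

/-- The reduced state `ρ_{SI}(t) = Tr_B 𝒰_0^t (ρ_S(0) ⊗ |Ω⟩⟨Ω|)` in the interaction picture. -/
def reducedState (t : ℝ) (ρ : SysOp N) : SysOp N :=
  partialTrace (stateDyn U₀ U 0 t (tensor ρ (vacuumProj N)))

/-- `Φ` is a linear superoperator such that `ρ_{SI}(t₂) = Φ (ρ_{SI}(t₁))` for every initial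
density matrix of the system. -/
def IsEvolutionMap (t₁ t₂ : ℝ) (Φ : SysOp N →ₗ[ℂ] SysOp N) : Prop :=
  ∀ ρ : SysOp N, ρ.PosSemidef → ρ.trace = 1 →
    reducedState U₀ U t₂ ρ = Φ (reducedState U₀ U t₁ ρ)

open Classical in
/-- The linear superoperator `Φ_{t₁}^{t₂}` such that `ρ_{SI}(t₂) = Φ_{t₁}^{t₂} (ρ_{SI}(t₁))`
(and `0` if there is none). -/
def evolutionMap (t₁ t₂ : ℝ) : SysOp N →ₗ[ℂ] SysOp N :=
  if h : ∃ Φ, IsEvolutionMap U₀ U t₁ t₂ Φ then h.choose else 0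

/-- The dipole operator `σ_h = (0 0; h 0)`. -/
def dipole (h : Fin N → ℂ) : SysOp N :=
  Matrix.fromBlocks 0 0 (Matrix.of fun i _ => h i) 0

/-- The ground state `|0⟩⟨0|` of the system. -/
def groundState (N : ℕ) : SysOp N := Matrix.single (Sum.inl ()) (Sum.inl ()) 1

/-- The correlation function by the quantum regression formula,
`⟨σ_{h₂}†(t₂) σ_{h₁}(t₁)⟩_M = Tr σ_{h₂}† Φ_{t₁}^{t₂} (σ_{h₁} Φ_0^{t₁} (|0⟩⟨0|))`. -/
def corrM (t₁ t₂ : ℝ) (h₁ h₂ : Fin N → ℂ) : ℂ :=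
  ((dipole h₂)ᴴ *
    evolutionMap U₀ U t₁ t₂ (dipole h₁ * evolutionMap U₀ U 0 t₁ (groundState N))).trace

/-- The operator whose trace is the exact correlation function,
`(σ_{h₂}† ⊗ I) 𝒰_{t₁}^{t₂} ((σ_{h₁} ⊗ I) 𝒰_0^{t₁} (|0⟩⟨0| ⊗ |Ω⟩⟨Ω|))`. -/
def corrOp (t₁ t₂ : ℝ) (h₁ h₂ : Fin N → ℂ) : Total N →L[ℂ] Total N :=
  tensor (dipole h₂)ᴴ 1 ∘L stateDyn U₀ U t₁ t₂
    (tensor (dipole h₁) 1 ∘L stateDyn U₀ U 0 t₁ (tensor (groundState N) (vacuumProj N)))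

/-- The exact correlation function `⟨σ_{h₂}†(t₂) σ_{h₁}(t₁)⟩`. -/
def corr (t₁ t₂ : ℝ) (h₁ h₂ : Fin N → ℂ) : ℂ := tr (corrOp U₀ U t₁ t₂ h₁ h₂)

end Dynamics

/-- The bath correlation function `G(t) = ∫ |g(k)|² e^{-i ω(k) t} dk`. -/
def bathCorr (ω : ℝ → ℝ) (g : ℝ → ℂ) (t : ℝ) : ℂ :=
  ∫ k : ℝ, ((‖g k‖ ^ 2 : ℝ) : ℂ) * Complex.exp (-Complex.I * ω k * t)

/-- `V` solves, on `t ≥ 0`, the initial value problem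
`V'(t) = -∫_0^t G(t-s) e^{i H_S (t-s)} V(s) ds`, `V(0) = I` (the equation is read
entry by entry). -/
structure IsPropagator {N : ℕ} (HS : Matrix (Fin N) (Fin N) ℂ) (G : ℝ → ℂ)
    (V : ℝ → Matrix (Fin N) (Fin N) ℂ) : Prop where
  init : V 0 = 1
  deriv : ∀ t : ℝ, 0 ≤ t → ∀ i j : Fin N,
    HasDerivWithinAt (fun s : ℝ => V s i j)
      (-∫ s in (0 : ℝ)..t,
        (G (t - s) • (NormedSpace.exp ((Complex.I * ((t - s : ℝ) : ℂ)) • HS) * V s)) i j)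
      (Set.Ici 0) t

end RWA

end

/-! The rotating-wave interaction conserves the number of excitations. The vector `|0⟩ ⊗ Ω` is
therefore fixed by both groups, and a system excitation `c` stays among the vectors `∑ c_i |i⟩ ⊗ Ω +
|0⟩ ⊗ φ` with a one-boson state `φ` (`sector`). There the free evolution is explicit
(`free_apply_sector`), and the interaction is the bounded map `(c, φ) ↦ (⟨f_i, φ⟩, ∑ c_i f_i)`,
where `⟨f_i, e^{-iωt} f_j⟩ = δ_ij G(t)`. Eliminating `φ` turns the Schrödinger equation into the
memory equation of `V`, so in the interaction picture `c` evolves to `V t c`. The proof goes in the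
opposite direction (`exists_interaction_picture_eq`): it builds the candidate vector from `V` and
checks that `U(-s) U₀(s)` sends it to a constant. The derivative of `U(-s) U₀(s)` contains only the
bounded interaction (`hasDerivAt_wave_operator`), so `φ` need not lie in the domain of the energy.

Starting at `t₁` instead of `0` conjugates the amplitude by `e^{i H_S t₁}`. The conjugate of `V`
solves the same equation and describes the same vector, hence equals `V`
(`propagator_conj_matrixGroup`). So the exact amplitude is `V (t₂ - t₁)`; the operator of the exact
correlation has the form `|y⟩⟨x|`, and its trace is an inner product.

For the regression formula, unitarity fixes the population that returns to the ground state, so the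
reduced dynamics is the amplitude damping channel of `1 ⊕ V t` (`reducedState_eq`). These channels
compose like their matrices and density matrices span, so for invertible `V t₁` the evolution map is
the channel of `V t₂ (V t₁)⁻¹` (`evolutionMap_eq`), which acts on a dipole by that matrix. Comparing
matrix entries gives the semigroup criterion. -/

noncomputable section

namespace RWA

/-! ### Strongly continuous unitary groups -/

section Groups

variable {E : Type} [NormedAddCommGroup E] [InnerProductSpace ℂ E]

/-- Product rule for a strongly continuous family of unitary operators. -/
theorem hasDerivWithinAt_unitary_apply {W : ℝ → E ≃ₗᵢ[ℂ] E}
    (hW : ∀ x, Continuous fun s => W s x) {z : ℝ → E} {z' w' : E} {S : Set ℝ} {t : ℝ}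
    (hz : HasDerivWithinAt z z' S t) (hw : HasDerivWithinAt (fun s => W s (z t)) w' S t) :
    HasDerivWithinAt (fun s => W s (z s)) (w' + W t z') S t := by
  -- Only strong continuity of `W` is available. The first-order remainder of `z` keeps its size
  -- under the isometries `W s`, and the linear term needs continuity only at the single vector
  -- `z'`.
  have key : HasDerivWithinAt (fun s => W s (z s - z t)) (W t z') S t := by
    rw [hasDerivWithinAt_iff_isLittleO] at hz ⊢
    have h1 : (fun s => W s (z s - z t - (s - t) • z')) =o[nhdsWithin t S] fun s => s - t :=
      (Asymptotics.isLittleO_norm_left.1 (by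
        simpa only [LinearIsometryEquiv.norm_map] using hz.norm_left))
    have h2 : (fun s => (s - t) • (W s z' - W t z')) =o[nhdsWithin t S] fun s => s - t := by
      have h3 : (fun s => W s z' - W t z') =o[nhdsWithin t S] fun _ => (1 : ℝ) := by
        rw [Asymptotics.isLittleO_one_iff]
        have := ((hW z').tendsto t).sub_const (W t z')
        rw [sub_self] at this
        exact this.mono_left nhdsWithin_le_nhds
      simpa using (Asymptotics.isBigO_refl (fun s : ℝ => s - t) (nhdsWithin t S)).smul_isLittleO h3
    refine (h1.add h2).congr_left fun s => ?_
    have h4 : W s ((s - t) • z') = (s - t) • W s z' := by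
      simpa only [Complex.real_smul, Complex.coe_smul] using (W s).map_smul ((s - t : ℝ) : ℂ) z'
    rw [map_sub (W s) (z s - z t), h4, sub_self (z t), map_zero]
    module
  exact (hw.add key).congr (fun s _ => by simp) (by simp)

namespace IsUnitaryGroup

variable {A : E → E → Prop} {U : ℝ → E ≃ₗᵢ[ℂ] E} (h : IsUnitaryGroup A U)
include h

theorem apply_zero (x : E) : U 0 x = x := by
  have := h.map_add 0 0 x
  rw [add_zero] at this
  exact ((U 0).injective this).symm

theorem neg_apply (t : ℝ) (x : E) : U (-t) (U t x) = x := by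
  rw [← h.map_add, neg_add_cancel, h.apply_zero]

theorem apply_neg (t : ℝ) (x : E) : U t (U (-t) x) = x := by
  rw [← h.map_add, add_neg_cancel, h.apply_zero]

theorem hasDerivAt {x y : E} (hxy : A x y) (t : ℝ) :
    HasDerivAt (fun s => U s x) (-Complex.I • U t y) t := by
  have h1 : HasDerivAt (fun s => U (s - t) x) (-Complex.I • y) t :=
    HasDerivAt.comp_sub_const t t (by rw [sub_self]; exact h.generator x y hxy)
  have h2 := (((U t).toContinuousLinearEquiv : E →L[ℂ] E).restrictScalars ℝ).hasFDerivAt.comp_hasDerivAt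
    t h1
  convert h2 using 1
  · funext s
    simp [← h.map_add]
  · simp

theorem hasDerivAt_apply_neg {x y : E} (hxy : A x y) (t : ℝ) :
    HasDerivAt (fun s => U (-s) x) (Complex.I • U (-t) y) t := by
  have := (h.hasDerivAt hxy (-t)).scomp t (hasDerivAt_neg t)
  simpa [Function.comp_def] using this

theorem continuous_apply_neg (x : E) : Continuous fun s => U (-s) x :=
  (h.continuous x).comp ContinuousNeg.continuous_neg

/-- `U` solves the Schrödinger equation uniquely. -/
theorem apply_eq {z y : ℝ → E} (hz : ∀ t, HasDerivAt z (-Complex.I • y t) t)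
    (hA : ∀ t, A (z t) (y t)) (t : ℝ) : U t (z 0) = z t := by
  -- Pulling a solution back by the group makes it stationary.
  have h1 : ∀ s, HasDerivAt (fun s => U (-s) (z s)) 0 s := fun s => by
    rw [← hasDerivWithinAt_univ]
    have := hasDerivWithinAt_unitary_apply (W := fun s => U (-s)) h.continuous_apply_neg
      (hz s).hasDerivWithinAt (h.hasDerivAt_apply_neg (hA s) s).hasDerivWithinAt (S := Set.univ)
    simpa using this
  have h2 := is_const_of_deriv_eq_zero (fun s => (h1 s).differentiableAt)
    (fun s => (h1 s).deriv) t 0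
  simp only [neg_zero, h.apply_zero] at h2
  rw [← h2, h.apply_neg]

theorem apply_eq_self {x : E} (hx : A x 0) (t : ℝ) : U t x = x :=
  h.apply_eq (z := fun _ => x) (y := fun _ => 0)
    (fun t => by simpa using hasDerivAt_const t x) (fun _ => hx) t

end IsUnitaryGroup

end Groups

/-! ### Traces of finite-rank operators -/

section Traces

variable {E : Type} [NormedAddCommGroup E] [InnerProductSpace ℂ E]

theorem HasTrace.add {S T : E →L[ℂ] E} {σ τ : ℂ} (hS : HasTrace S σ) (hT : HasTrace T τ) :
    HasTrace (S + T) (σ + τ) := fun ι b => by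
  simpa [inner_add_right] using (hS ι b).add (hT ι b)

theorem HasTrace.smul {T : E →L[ℂ] E} {τ : ℂ} (c : ℂ) (hT : HasTrace T τ) :
    HasTrace (c • T) (c * τ) := fun ι b => by
  simpa [inner_smul_right] using (hT ι b).mul_left c

theorem hasTrace_zero : HasTrace (0 : E →L[ℂ] E) 0 := fun ι b => by
  simp [hasSum_zero]

theorem HasTrace.sum {κ : Type*} (s : Finset κ) {T : κ → E →L[ℂ] E} {τ : κ → ℂ}
    (h : ∀ k ∈ s, HasTrace (T k) (τ k)) : HasTrace (∑ k ∈ s, T k) (∑ k ∈ s, τ k) := by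
  classical
  induction s using Finset.induction_on with
  | empty => simpa using hasTrace_zero
  | insert a s ha ih =>
    rw [Finset.sum_insert ha, Finset.sum_insert ha]
    exact (h a (by simp)).add (ih fun k hk => h k (by simp [hk]))

/-- This is Parseval's identity in an arbitrary basis. -/
theorem hasTrace_rankOne (x y : E) :
    HasTrace (InnerProductSpace.rankOne ℂ x y) (inner ℂ y x) := fun ι b => by
  simpa [inner_smul_right] using b.hasSum_inner_mul_inner y x

/-- Completeness supplies a Hilbert basis, and sums in that basis are unique; with no basis at all
every number would qualify as a trace. -/
theorem HasTrace.tr_eq [CompleteSpace E] {T : E →L[ℂ] E} {τ : ℂ} (h : HasTrace T τ) :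
    tr T = τ := by
  have hex : ∃ τ, HasTrace T τ := ⟨τ, h⟩
  obtain ⟨w, b, -⟩ := exists_hilbertBasis ℂ E
  rw [tr, dif_pos hex]
  exact (hex.choose_spec _ b).unique (h _ b)

theorem conjBy_rankOne (U : E ≃ₗᵢ[ℂ] E) (x y : E) :
    conjBy U (InnerProductSpace.rankOne ℂ x y) = InnerProductSpace.rankOne ℂ (U x) (U y) := by
  ext z
  simp [conjBy, LinearIsometryEquiv.inner_map_eq_flip]

/-- Each superoperator keeps the form `|·⟩⟨x|`: the bra stays `x` because both unitaries fix it, and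
the ket travels `x ↦ z ↦ w ↦ S w`. -/
theorem hasTrace_comp_conjBy_comp_conjBy {R S T : E →L[ℂ] E} {U U' : E ≃ₗᵢ[ℂ] E} {x z w : E}
    (hR : R = InnerProductSpace.rankOne ℂ x x) (hx : U x = x) (hx' : U' x = x) (hz : T x = z)
    (hw : U' z = w) :
    HasTrace (S ∘L conjBy U' (T ∘L conjBy U R)) (inner ℂ x (S w)) := by
  rw [hR, conjBy_rankOne, InnerProductSpace.comp_rankOne, conjBy_rankOne,
    InnerProductSpace.comp_rankOne, hx, hx', hz, hw]
  exact hasTrace_rankOne _ _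

end Traces

/-! ### The matrix group of the system Hamiltonian -/

section MatrixExp

variable {N : ℕ}

/-- The unitary group `e^{-i H t}` of a matrix `H`. -/
def matrixGroup (H : Matrix (Fin N) (Fin N) ℂ) (t : ℝ) : Matrix (Fin N) (Fin N) ℂ :=
  NormedSpace.exp ((-(Complex.I * t)) • H)

theorem matrixGroup_zero (H : Matrix (Fin N) (Fin N) ℂ) : matrixGroup H 0 = 1 := by
  simp [matrixGroup]

theorem matrixGroup_neg (H : Matrix (Fin N) (Fin N) ℂ) (t : ℝ) :
    matrixGroup H (-t) = NormedSpace.exp ((Complex.I * (t : ℂ)) • H) := by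
  rw [matrixGroup]; congr 2; push_cast; ring

theorem matrixGroup_add (H : Matrix (Fin N) (Fin N) ℂ) (s t : ℝ) :
    matrixGroup H (s + t) = matrixGroup H s * matrixGroup H t := by
  rw [matrixGroup, matrixGroup, matrixGroup, ← Matrix.exp_add_of_commute]
  · congr 1
    push_cast
    module
  · exact ((Commute.refl H).smul_left _).smul_right _

theorem commute_matrixGroup (H : Matrix (Fin N) (Fin N) ℂ) (s t : ℝ) :
    Commute (matrixGroup H s) (matrixGroup H t) := by
  rw [Commute, SemiconjBy, ← matrixGroup_add, ← matrixGroup_add, add_comm]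

section
attribute [local instance] Matrix.linftyOpNormedRing Matrix.linftyOpNormedAlgebra

/-- A matrix norm is needed only to differentiate the exponential; the entrywise form does not
depend on which one is chosen. -/
theorem hasDerivAt_matrixGroup_apply (H : Matrix (Fin N) (Fin N) ℂ) (t : ℝ) (i j : Fin N) :
    HasDerivAt (fun s => matrixGroup H s i j) (-Complex.I * (H * matrixGroup H t) i j) t := by
  have h1 : HasDerivAt (fun s : ℝ => matrixGroup H s) (-Complex.I • (H * matrixGroup H t)) t := by
    have h2 := hasDerivAt_exp_smul_const' (𝕂 := ℂ) H (-(Complex.I * t))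
    have h3 : HasDerivAt (fun s : ℝ => -(Complex.I * (s : ℂ))) (-Complex.I) t := by
      exact ((Complex.ofRealCLM.hasDerivAt (x := t)).const_mul Complex.I).neg.congr_deriv (by simp)
    exact h2.scomp t h3
  have h4 := hasDerivAt_pi.1 (hasDerivAt_pi.1 h1 i) j
  simpa using h4
end

theorem hasDerivAt_matrixGroup_mulVec (H : Matrix (Fin N) (Fin N) ℂ) (c : Fin N → ℂ) (t : ℝ) :
    HasDerivAt (fun s => matrixGroup H s *ᵥ c)
      (-Complex.I • (H *ᵥ (matrixGroup H t *ᵥ c))) t := by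
  rw [hasDerivAt_pi]
  intro i
  have := HasDerivAt.fun_sum (u := Finset.univ) fun j _ =>
    (hasDerivAt_matrixGroup_apply H t i j).mul_const (c j)
  refine this.congr_deriv ?_
  rw [Matrix.mulVec_mulVec]
  simp only [Pi.smul_apply, smul_eq_mul, Matrix.mulVec, dotProduct, Finset.mul_sum, mul_assoc]

theorem continuous_matrixGroup (H : Matrix (Fin N) (Fin N) ℂ) : Continuous (matrixGroup H) :=
  continuous_matrix fun i j => continuous_iff_continuousAt.2 fun t =>
    (hasDerivAt_matrixGroup_apply H t i j).continuousAt

end MatrixExp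

/-! ### The memory equation and its symmetry -/

section Propagator

variable {N : ℕ} {HS : Matrix (Fin N) (Fin N) ℂ} {G : ℝ → ℂ}
  {V : ℝ → Matrix (Fin N) (Fin N) ℂ}

/-- The integrand of the memory kernel. -/
def memoryTerm (HS : Matrix (Fin N) (Fin N) ℂ) (G : ℝ → ℂ) (V : ℝ → Matrix (Fin N) (Fin N) ℂ)
    (t s : ℝ) : Matrix (Fin N) (Fin N) ℂ :=
  G (t - s) • (matrixGroup HS (-(t - s)) * V s)

theorem IsPropagator.hasDerivWithinAt (hV : IsPropagator HS G V) {t : ℝ} (ht : 0 ≤ t)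
    (i j : Fin N) : HasDerivWithinAt (fun s => V s i j)
      (-∫ s in (0 : ℝ)..t, memoryTerm HS G V t s i j) (Set.Ici 0) t := by
  simpa only [memoryTerm, matrixGroup_neg] using hV.deriv t ht i j

theorem IsPropagator.continuousOn (hV : IsPropagator HS G V) : ContinuousOn V (Set.Ici 0) :=
  continuousOn_pi.2 fun i => continuousOn_pi.2 fun j => fun _ ht =>
    (hV.hasDerivWithinAt ht i j).continuousWithinAt

theorem IsPropagator.intervalIntegrable_memoryTerm (hV : IsPropagator HS G V) (hG : Continuous G)
    {t : ℝ} (ht : 0 ≤ t) (i j : Fin N) :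
    IntervalIntegrable (fun s => memoryTerm HS G V t s i j) volume 0 t := by
  apply ContinuousOn.intervalIntegrable
  have h1 : ContinuousOn (fun s => memoryTerm HS G V t s) (Set.uIcc 0 t) := by
    unfold memoryTerm
    refine (hG.comp (continuous_const.sub continuous_id)).continuousOn.smul
      (ContinuousOn.mul ?_ (hV.continuousOn.mono ?_))
    · exact ((continuous_matrixGroup HS).comp (by fun_prop)).continuousOn
    · rw [Set.uIcc_of_le ht]; exact Set.Icc_subset_Ici_self
  exact continuousOn_pi.1 (continuousOn_pi.1 h1 i) j

/-- The conjugate of a propagator by the free evolution is a propagator. -/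
theorem IsPropagator.conj (hV : IsPropagator HS G V) (hG : Continuous G) (a : ℝ) :
    IsPropagator HS G fun t => matrixGroup HS (-a) * V t * matrixGroup HS a where
  init := by
    rw [hV.init, mul_one, ← matrixGroup_add, neg_add_cancel, matrixGroup_zero]
  deriv t ht i j := by
    have key : ∀ X : Matrix (Fin N) (Fin N) ℂ,
        (matrixGroup HS (-a) * X * matrixGroup HS a) i j =
          ∑ l, ∑ k, matrixGroup HS (-a) i k * X k l * matrixGroup HS a l j := fun X => by
      simp only [Matrix.mul_apply, Finset.sum_mul]
    have h1 := HasDerivWithinAt.fun_sum (u := Finset.univ) fun l _ =>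
      HasDerivWithinAt.fun_sum (u := Finset.univ) fun k _ =>
        ((hV.hasDerivWithinAt ht k l).const_mul (matrixGroup HS (-a) i k)).mul_const
          (matrixGroup HS a l j)
    have h2 : ∀ s, (G (t - s) • (NormedSpace.exp ((Complex.I * ((t - s : ℝ) : ℂ)) • HS) *
        (matrixGroup HS (-a) * V s * matrixGroup HS a))) i j =
          ∑ l, ∑ k, matrixGroup HS (-a) i k * memoryTerm HS G V t s k l *
            matrixGroup HS a l j := fun s => by
      rw [← key, memoryTerm]
      rw [← matrixGroup_neg, Matrix.mul_smul, Matrix.smul_mul]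
      -- The kernel is a scalar times an element of the same matrix group, so conjugation by that
      -- group passes through it.
      rw [← mul_assoc, ← mul_assoc, ← mul_assoc, (commute_matrixGroup HS _ _).eq]
    have hi := hV.intervalIntegrable_memoryTerm hG ht
    refine (h1.congr_deriv ?_).congr (fun s _ => key (V s)) (key (V t))
    refine Eq.trans ?_ (congrArg Neg.neg (intervalIntegral.integral_congr fun s _ => (h2 s).symm))
    rw [intervalIntegral.integral_finsetSum fun l _ => ?_]
    · rw [← Finset.sum_neg_distrib]
      refine Finset.sum_congr rfl fun l _ => Eq.symm ?_
      rw [intervalIntegral.integral_finsetSum fun k _ =>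
        ((hi k l).const_mul _).mul_const _, ← Finset.sum_neg_distrib]
      refine Finset.sum_congr rfl fun k _ => ?_
      rw [intervalIntegral.integral_mul_const, intervalIntegral.integral_const_mul]
      ring
    · simpa only [Finset.sum_fn] using
        IntervalIntegrable.sum Finset.univ fun k _ => ((hi k l).const_mul
          (matrixGroup HS (-a) i k)).mul_const (matrixGroup HS a l j)

end Propagator

/-! ### From the memory equation to the dynamics with one excitation -/

section Sector

variable {N : ℕ} {HS : Matrix (Fin N) (Fin N) ℂ} {G : ℝ → ℂ}
  {V : ℝ → Matrix (Fin N) (Fin N) ℂ}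
  {E F : Type} [NormedAddCommGroup E] [InnerProductSpace ℂ E]
  [NormedAddCommGroup F] [InnerProductSpace ℂ F] [CompleteSpace F]

/-- The interaction picture dynamics of the excited states in a sector `S : ℂ^N ⊕ F → E` in which
the interaction is `(c, φ) ↦ (⟨f i, φ⟩, ∑ i, c i f i)`. -/
theorem exists_interaction_picture_eq {A₀ A : E → E → Prop} {U₀ U : ℝ → E ≃ₗᵢ[ℂ] E}
    (hU₀ : IsUnitaryGroup A₀ U₀) (hU : IsUnitaryGroup A U)
    (S : ((Fin N → ℂ) × F) →L[ℂ] E) (P : ℝ → F →ₗᵢ[ℂ] F)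
    (hPc : ∀ φ, Continuous fun t => P t φ) (hPadd : ∀ s t φ, P (s + t) φ = P s (P t φ))
    (hP0 : ∀ φ, P 0 φ = φ)
    (h0 : ∀ t c φ, U₀ t (S (c, φ)) = S (matrixGroup HS t *ᵥ c, P t φ)) (f : Fin N → F)
    (hG : Continuous G) (hf : ∀ i j t, inner ℂ (f i) (P t (f j)) = if i = j then G t else 0)
    (hD : ∀ c φ s, HasDerivAt (fun s => U (-s) (U₀ s (S (c, φ))))
      (Complex.I • U (-s) (S (fun i => inner ℂ (f i) (P s φ),
        ∑ i, (matrixGroup HS s *ᵥ c) i • f i))) s)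
    (hV : IsPropagator HS G V) (c : Fin N → ℂ) {t : ℝ} (ht : 0 ≤ t) :
    ∃ φ, U₀ (-t) (U t (S (c, 0))) = S (V t *ᵥ c, φ) := by
  -- Nothing is known about `V` at negative times. Freezing it at `V 0` there makes the amplitude
  -- continuous on all of `ℝ`, so that its integrals are differentiable everywhere.
  set a : ℝ → Fin N → ℂ := fun r => matrixGroup HS r *ᵥ (V (max r 0) *ᵥ c) with ha
  have hac : Continuous a := by
    have h1 : Continuous fun r => V (max r 0) :=
      hV.continuousOn.comp_continuous (by fun_prop) fun r => Set.mem_Ici.2 (le_max_right _ _)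
    exact (continuous_matrixGroup HS).matrix_mulVec (h1.matrix_mulVec continuous_const)
  -- The rate at which excited levels emit a boson, in the interaction picture; its integral is the
  -- boson component of the candidate.
  set q : ℝ → F := fun r => -Complex.I • ∑ m, a r m • P (-r) (f m) with hq
  have hqc : Continuous q := by
    refine continuous_const.smul (continuous_finsetSum _ fun m _ => ?_)
    exact ((continuous_apply m).comp hac).smul ((hPc (f m)).comp continuous_neg)
  set φ : ℝ → F := fun s => ∫ r in (0 : ℝ)..s, q r with hφ
  have hφd : ∀ s, HasDerivAt φ (q s) s := fun s => hqc.integral_hasStrictDerivAt 0 s |>.hasDerivAt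
  have hadj : ∀ s x y, inner ℂ x (P s y) = inner ℂ (P (-s) x) y := fun s x y => by
    rw [← (P s).inner_map_map (P (-s) x) y, ← hPadd, add_neg_cancel, hP0]
  -- Reabsorption into level `i` sees only bosons emitted from level `i`, since different reservoirs
  -- are orthogonal; the overlap is the kernel at the elapsed time `s - r`.
  have hamp : ∀ s i, inner ℂ (f i) (P s (φ s)) =
      -Complex.I * ∫ r in (0 : ℝ)..s, a r i * G (s - r) := fun s i => by
    rw [hadj, hφ, ← innerSL_apply_apply ℂ,
      ← ContinuousLinearMap.intervalIntegral_comp_comm _ (hqc.intervalIntegrable _ _),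
      ← intervalIntegral.integral_const_mul]
    congr 1
    funext r
    rw [innerSL_apply_apply, hq, inner_smul_right, inner_sum]
    congr 1
    have h1 : ∀ m, inner ℂ (P (-s) (f i)) (P (-r) (f m)) = if i = m then G (s - r) else 0 :=
      fun m => by rw [← hadj, ← hPadd, ← sub_eq_add_neg, hf]
    simp [inner_smul_right, h1]
  set v : ℝ → Fin N → ℂ := fun s => V s *ᵥ c with hv
  -- This is the memory equation with its integral recognised as the reabsorption amplitude: the
  -- minus sign is `(-i)(-i)`, one factor for emission and one for absorption.
  have hvd : ∀ s, 0 ≤ s → HasDerivWithinAt v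
      (-Complex.I • (matrixGroup HS (-s) *ᵥ fun i => inner ℂ (f i) (P s (φ s)))) (Set.Ici 0) s := by
    intro s hs
    rw [hasDerivWithinAt_pi]
    intro i
    have h1 := HasDerivWithinAt.fun_sum (u := Finset.univ) fun j _ =>
      (hV.hasDerivWithinAt hs i j).mul_const (c j)
    refine h1.congr_deriv ?_
    simp only [hamp, Pi.smul_apply, Matrix.mulVec, dotProduct, smul_eq_mul]
    have hi := hV.intervalIntegrable_memoryTerm hG hs
    have h2 : ∑ j, (-∫ r in (0 : ℝ)..s, memoryTerm HS G V s r i j) * c j =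
        -∫ r in (0 : ℝ)..s, ∑ j, memoryTerm HS G V s r i j * c j := by
      rw [intervalIntegral.integral_finsetSum fun j _ => (hi i j).mul_const _,
        ← Finset.sum_neg_distrib]
      simp only [intervalIntegral.integral_mul_const, neg_mul]
    have h3 : ∑ l, matrixGroup HS (-s) i l * (-Complex.I * ∫ r in (0 : ℝ)..s, a r l * G (s - r)) =
        -Complex.I * ∫ r in (0 : ℝ)..s, ∑ l, matrixGroup HS (-s) i l * (a r l * G (s - r)) := by
      rw [intervalIntegral.integral_finsetSum fun l _ => ?_, Finset.mul_sum]
      · refine Finset.sum_congr rfl fun l _ => ?_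
        rw [intervalIntegral.integral_const_mul]; ring
      · refine Continuous.intervalIntegrable ?_ _ _
        have := (continuous_apply l).comp hac
        exact continuous_const.mul (this.mul (hG.comp (by fun_prop)))
    rw [h2, h3, eq_comm, ← mul_assoc, neg_mul_neg, Complex.I_mul_I, neg_one_mul]
    congr 1
    refine intervalIntegral.integral_congr fun r hr => ?_
    rw [Set.uIcc_of_le hs] at hr
    have h4 : (memoryTerm HS G V s r *ᵥ c) i = G (s - r) * (matrixGroup HS (-s) *ᵥ a r) i := by
      rw [ha, memoryTerm]
      simp only [max_eq_left hr.1]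
      rw [Matrix.smul_mulVec, Matrix.mulVec_mulVec, Matrix.mulVec_mulVec,
        ← matrixGroup_add, neg_sub, Pi.smul_apply, smul_eq_mul, neg_add_eq_sub]
    change _ = (memoryTerm HS G V s r *ᵥ c) i
    rw [h4, Matrix.mulVec, dotProduct, Finset.mul_sum]
    exact Finset.sum_congr rfl fun l _ => by ring
  set Y : ℝ → E := fun s => S (v s, φ s) with hY
  set W : ℝ → E ≃ₗᵢ[ℂ] E := fun s => (U₀ s).trans (U (-s)) with hW
  have hWc : ∀ x, Continuous fun s => W s x := fun x => by
    -- A composite of strongly continuous isometries is jointly continuous, because the outer one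
    -- preserves the error of the inner one.
    have h1 : Continuous fun p : ℝ × ℝ => U (-p.1) (U₀ p.2 x) := by
      refine continuous_iff_continuousAt.2 fun p => ?_
      have h2 : Filter.Tendsto (fun q : ℝ × ℝ => U (-q.1) (U₀ q.2 x) - U (-q.1) (U₀ p.2 x))
          (nhds p) (nhds 0) := by
        rw [tendsto_zero_iff_norm_tendsto_zero]
        simp only [← map_sub, LinearIsometryEquiv.norm_map]
        have := (((hU₀.continuous x).comp continuous_snd).sub
          (continuous_const (y := U₀ p.2 x))).norm.tendsto p
        simpa using this
      have h3 := h2.add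
        (((hU.continuous_apply_neg (U₀ p.2 x)).comp (continuous_fst (Y := ℝ))).tendsto p)
      simpa [ContinuousAt] using h3
    exact h1.comp (continuous_id.prodMk continuous_id)
  -- The velocity of the candidate contributes `-i` times the interaction, and the derivative of `W`
  -- contributes `+i` times it.
  have hconst : ∀ s, 0 ≤ s → HasDerivWithinAt (fun s => W s (Y s)) 0 (Set.Ici 0) s := by
    intro s hs
    have hYd : HasDerivWithinAt Y (S (-Complex.I • (matrixGroup HS (-s) *ᵥ
        fun i => inner ℂ (f i) (P s (φ s))), q s)) (Set.Ici 0) s := by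
      have h1 := (S.restrictScalars ℝ).hasFDerivAt.comp_hasDerivWithinAt s
        ((hvd s hs).prodMk (hφd s).hasDerivWithinAt)
      exact h1
    have h2 := hasDerivWithinAt_unitary_apply hWc hYd (hD (v s) (φ s) s).hasDerivWithinAt
    convert h2 using 1
    change (0 : E) = _ + U (-s) (U₀ s _)
    rw [h0, ← map_smul, ← map_add, ← map_smul, ← map_add]
    have h3 : P s (q s) = -Complex.I • ∑ m, a s m • f m := by
      simp only [hq, map_smul, map_sum, ← hPadd, add_neg_cancel, hP0]
    have h4 : a s = matrixGroup HS s *ᵥ v s := by simp [ha, hv, max_eq_left hs]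
    rw [h3, Matrix.mulVec_smul, Matrix.mulVec_mulVec _ (matrixGroup HS s) (matrixGroup HS (-s)), ← matrixGroup_add, add_neg_cancel,
      matrixGroup_zero, Matrix.one_mulVec, h4, Prod.smul_mk, Prod.mk_add_mk]
    simp [← Prod.zero_eq_mk]
  have hfin := constant_of_has_deriv_right_zero (a := 0) (b := t) (f := fun s => W s (Y s))
    (fun s hs => ((hconst s hs.1).continuousWithinAt).mono Set.Icc_subset_Ici_self)
    (fun s hs => (hconst s hs.1).mono (Set.Ici_subset_Ici.2 hs.1)) t ⟨ht, le_rfl⟩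
  refine ⟨φ t, ?_⟩
  have h5 : W 0 (Y 0) = S (c, 0) := by
    simp [hW, hY, hU.apply_zero, hU₀.apply_zero, hv, hφ, hV.init]
  rw [h5] at hfin
  rw [← hfin]
  simp only [hW, LinearIsometryEquiv.trans_apply]
  rw [hU.apply_neg, hU₀.neg_apply]

end Sector

/-! ### Wave functions of the vectors with at most one excitation -/

section Waves

variable {N : ℕ}

theorem confMeasure_ne_zero (n : ℕ) [Nonempty (Fin n → Mode N)] : confMeasure N n ≠ 0 := by
  rw [← Measure.measure_univ_ne_zero, Measure.pi_univ, Finset.prod_ne_zero_iff]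
  intro r _
  obtain ⟨x⟩ := ‹Nonempty (Fin n → Mode N)›
  have : Nonempty (Fin N) := ⟨(x r).1⟩
  rw [modeMeasure, ← Set.univ_prod_univ, Measure.prod_prod]
  refine mul_ne_zero ?_ (by simp)
  rw [Measure.measure_univ_ne_zero]
  exact NeZero.ne _

/-- The representative of a constant wave function is constant. -/
theorem coeFn_eq_const {n : ℕ} {φ : Lp ℂ 2 (confMeasure N n)} {c : ℂ}
    (h : φ =ᵐ[confMeasure N n] fun _ => c) : (φ : (Fin n → Mode N) → ℂ) = fun _ => c := by
  -- For `N = 0` and `n ≥ 1` the measure vanishes, but then there are no configurations. Equality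
  -- everywhere, not just almost everywhere, allows a wave function to be evaluated inside `intTerm`
  -- without discussing null sets.
  rcases isEmpty_or_nonempty (Fin n → Mode N) with he | hne
  · exact funext fun x => he.elim x
  · have : NeZero (confMeasure N n) := ⟨confMeasure_ne_zero n⟩
    have h1 : (φ : (Fin n → Mode N) →ₘ[confMeasure N n] ℂ) = AEEqFun.const _ c :=
      AEEqFun.ext (h.trans (AEEqFun.coeFn_const _ c).symm)
    funext x
    rw [h1, AEEqFun.coeFn_const_eq]

theorem coeFn_bosonSpace_zero (n : ℕ) :
    (((0 : bosonSpace N n) : Lp ℂ 2 (confMeasure N n)) : (Fin n → Mode N) → ℂ) = 0 :=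
  coeFn_eq_const (Lp.coeFn_zero ℂ 2 (confMeasure N n))

theorem coeFn_smul_zeroBoson (c : ℂ) :
    (((c • zeroBoson N : bosonSpace N 0) : Lp ℂ 2 (confMeasure N 0)) :
      (Fin 0 → Mode N) → ℂ) = fun _ => c := by
  refine coeFn_eq_const ?_
  refine (Lp.coeFn_smul c (zeroBoson N : Lp ℂ 2 (confMeasure N 0))).trans ?_
  have h : ((zeroBoson N : bosonSpace N 0) : Lp ℂ 2 (confMeasure N 0)) =ᵐ[confMeasure N 0] _ :=
    indicatorConstLp_coeFn (hs := MeasurableSet.univ) (hμs := by simp [confMeasure])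
  filter_upwards [h] with x hx
  simp [hx]

/-- The wave functions of one boson. -/
abbrev OneBoson (N : ℕ) : Type := Lp ℂ 2 (confMeasure N 1)

theorem mem_bosonSpace_one (φ : OneBoson N) : φ ∈ bosonSpace N 1 := by
  rw [bosonSpace, Submodule.mem_iInf]
  intro σ
  obtain rfl : σ = 1 := Subsingleton.elim _ _
  rw [LinearMap.mem_ker]
  refine sub_eq_zero.2 (Lp.ext ?_)
  exact Lp.coeFn_compMeasurePreserving _ (measurePreserving_perm N 1 1)

/-- One-boson states as elements of the Fock space. -/
def oneBosonFock (N : ℕ) : OneBoson N →L[ℂ] Fock N :=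
  lp.singleContinuousLinearMap ℂ (fun n => bosonSpace N n) 2 1 ∘L
    (ContinuousLinearMap.id ℂ (OneBoson N)).codRestrict (bosonSpace N 1) mem_bosonSpace_one

theorem oneBosonFock_apply (φ : OneBoson N) :
    oneBosonFock N φ = lp.single 2 1 (⟨φ, mem_bosonSpace_one φ⟩ : bosonSpace N 1) := rfl

theorem norm_oneBosonFock (φ : OneBoson N) : ‖oneBosonFock N φ‖ = ‖φ‖ := by
  rw [oneBosonFock_apply, lp.norm_single (by norm_num)]
  rfl

theorem inner_vacuum_oneBosonFock (φ : OneBoson N) :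
    inner ℂ (vacuum N) (oneBosonFock N φ) = 0 := by
  rw [vacuum, lp.inner_single_left, oneBosonFock_apply, lp.single_apply_ne _ _ _ (by norm_num),
    inner_zero_right]

theorem inner_oneBosonFock_vacuum (φ : OneBoson N) :
    inner ℂ (oneBosonFock N φ) (vacuum N) = 0 := by
  rw [← inner_conj_symm, inner_vacuum_oneBosonFock, map_zero]

theorem norm_vacuum (N : ℕ) : ‖vacuum N‖ = 1 := by
  rw [vacuum, lp.norm_single (by norm_num)]
  change ‖indicatorConstLp 2 (μ := confMeasure N 0) MeasurableSet.univ (by simp [confMeasure])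
    (1 : ℂ)‖ = 1
  rw [norm_indicatorConstLp (by norm_num) (by norm_num)]
  simp [confMeasure, Measure.real]

/-- The product vector `|a⟩ ⊗ x`. -/
def ket (a : Level N) (x : Fock N) : Total N := WithLp.toLp 2 (Pi.single a x)

theorem ket_apply_self (a : Level N) (x : Fock N) : ket a x a = x := by simp [ket]

theorem ket_apply_ne {a b : Level N} (h : b ≠ a) (x : Fock N) : ket a x b = 0 := by
  rw [ket, PiLp.toLp_apply, Pi.single_eq_of_ne h]

/-- The sector `∑ i, c i |i⟩ ⊗ |Ω⟩ + |0⟩ ⊗ φ` with one excitation. -/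
def sector (N : ℕ) : ((Fin N → ℂ) × OneBoson N) →L[ℂ] Total N :=
  ((PiLp.continuousLinearEquiv 2 ℂ fun _ : Level N => Fock N).symm :
      (Level N → Fock N) →L[ℂ] Total N) ∘L
    ContinuousLinearMap.pi (Sum.elim
      (fun _ => oneBosonFock N ∘L ContinuousLinearMap.snd ℂ (Fin N → ℂ) (OneBoson N))
      (fun i => (ContinuousLinearMap.proj (R := ℂ) (φ := fun _ : Fin N => ℂ) i ∘L
        ContinuousLinearMap.fst ℂ (Fin N → ℂ) (OneBoson N)).smulRight (vacuum N)))

theorem sector_inl (c : Fin N → ℂ) (φ : OneBoson N) (u : Unit) :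
    sector N (c, φ) (Sum.inl u) = oneBosonFock N φ := rfl

theorem sector_inr (c : Fin N → ℂ) (φ : OneBoson N) (i : Fin N) :
    sector N (c, φ) (Sum.inr i) = c i • vacuum N := rfl

theorem wave_of_eq_zero {Ψ : Total N} {j : Level N} {n : ℕ} (h : Ψ j n = 0) : wave Ψ j n = 0 := by
  rw [wave, h, coeFn_bosonSpace_zero]

theorem wave_sector_inl_one (c : Fin N → ℂ) (φ : OneBoson N) (u : Unit) :
    wave (sector N (c, φ)) (Sum.inl u) 1 = φ := by
  rw [wave, sector_inl, oneBosonFock_apply, lp.single_apply_self]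

theorem wave_sector_inl_ne (c : Fin N → ℂ) (φ : OneBoson N) (u : Unit) {n : ℕ} (hn : n ≠ 1) :
    wave (sector N (c, φ)) (Sum.inl u) n = 0 :=
  wave_of_eq_zero (by rw [sector_inl, oneBosonFock_apply, lp.single_apply_ne _ _ _ hn])

theorem wave_sector_inr_zero (c : Fin N → ℂ) (φ : OneBoson N) (i : Fin N) :
    wave (sector N (c, φ)) (Sum.inr i) 0 = fun _ => c i := by
  rw [wave, sector_inr, lp.coeFn_smul, Pi.smul_apply, vacuum, lp.single_apply_self,
    coeFn_smul_zeroBoson]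

theorem wave_sector_inr_ne (c : Fin N → ℂ) (φ : OneBoson N) (i : Fin N) {n : ℕ} (hn : n ≠ 0) :
    wave (sector N (c, φ)) (Sum.inr i) n = 0 :=
  wave_of_eq_zero (by
    rw [sector_inr, lp.coeFn_smul, Pi.smul_apply, vacuum, lp.single_apply_ne _ _ _ hn, smul_zero])

theorem wave_ket_vacuum_ne (j : Level N) {n : ℕ} (hn : n ≠ 0) :
    wave (ket (Sum.inl ()) (vacuum N)) j n = 0 := by
  refine wave_of_eq_zero ?_
  rcases j with ⟨⟩ | i
  · rw [ket_apply_self, vacuum, lp.single_apply_ne _ _ _ hn]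
  · rw [ket_apply_ne (by simp)]; rfl

theorem wave_ket_vacuum_inr (i : Fin N) (n : ℕ) :
    wave (ket (Sum.inl ()) (vacuum N)) (Sum.inr i) n = 0 :=
  wave_of_eq_zero (by rw [ket_apply_ne (by simp)]; rfl)

theorem wave_zero (j : Level N) (n : ℕ) : wave (0 : Total N) j n = 0 := wave_of_eq_zero rfl

end Waves

/-! ### The Hamiltonians on the ground state and on the sector -/

section Hamiltonians

variable {N : ℕ} (HS : Matrix (Fin N) (Fin N) ℂ) (ω : ℝ → ℝ) (g : ℝ → ℂ)

theorem sysTerm_inl (Ψ : Total N) (u : Unit) (n : ℕ) (x : Fin n → Mode N) :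
    sysTerm HS Ψ (Sum.inl u) n x = 0 := by
  simp [sysTerm, sysHam]

theorem sysTerm_inr (Ψ : Total N) (i : Fin N) (n : ℕ) (x : Fin n → Mode N) :
    sysTerm HS Ψ (Sum.inr i) n x = ∑ l, HS i l * wave Ψ (Sum.inr l) n x := by
  simp [sysTerm, sysHam]

theorem finitelyManyBosons_sector (c : Fin N → ℂ) (φ : OneBoson N) :
    FinitelyManyBosons (sector N (c, φ)) := by
  refine ⟨2, fun j n hn => ?_⟩
  rcases j with u | i
  · rw [wave_sector_inl_ne _ _ _ (by omega)]
  · rw [wave_sector_inr_ne _ _ _ (by omega)]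

theorem finitelyManyBosons_ket_vacuum :
    FinitelyManyBosons (ket (Sum.inl ()) (vacuum N) : Total N) :=
  ⟨1, fun j n hn => by rw [wave_ket_vacuum_ne j (by omega)]⟩

theorem bathTerm_ket_vacuum (j : Level N) (n : ℕ) (x : Fin n → Mode N) :
    bathTerm ω (ket (Sum.inl ()) (vacuum N)) j n x = 0 := by
  rcases n with _ | n
  · simp [bathTerm]
  · simp [bathTerm, wave_ket_vacuum_ne]

theorem sysTerm_ket_vacuum (j : Level N) (n : ℕ) (x : Fin n → Mode N) :
    sysTerm HS (ket (Sum.inl ()) (vacuum N)) j n x = 0 := by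
  rcases j with u | i
  · rw [sysTerm_inl]
  · simp [sysTerm_inr, wave_ket_vacuum_inr]

theorem freeHam_ket_vacuum : freeHam HS ω (ket (Sum.inl ()) (vacuum N)) 0 := by
  refine ⟨finitelyManyBosons_ket_vacuum, fun j n => .of_forall fun x => ?_⟩
  simp [wave_zero, bathTerm_ket_vacuum, sysTerm_ket_vacuum]

theorem fullHam_ket_vacuum : fullHam HS ω g (ket (Sum.inl ()) (vacuum N)) 0 := by
  refine ⟨finitelyManyBosons_ket_vacuum, fun j n => .of_forall fun x => ?_⟩
  have h : intTerm g (ket (Sum.inl ()) (vacuum N)) j n x = 0 := by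
    rcases j with u | i
    · rcases n with _ | n
      · rfl
      · simp [intTerm, wave_ket_vacuum_inr]
    · simp [intTerm, wave_ket_vacuum_ne]
  simp [wave_zero, bathTerm_ket_vacuum, sysTerm_ket_vacuum, h]

variable {ω} in
theorem freeHam_sector (c : Fin N → ℂ) {φ ψ : OneBoson N}
    (h : ψ =ᵐ[confMeasure N 1] fun x => (ω (x 0).2 : ℂ) * φ x) :
    freeHam HS ω (sector N (c, φ)) (sector N (HS *ᵥ c, ψ)) := by
  refine ⟨finitelyManyBosons_sector c φ, fun j n => ?_⟩
  rcases j with u | i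
  · rcases eq_or_ne n 1 with rfl | hn
    · filter_upwards [h] with x hx
      simp [sysTerm_inl, bathTerm, wave_sector_inl_one, hx]
    · refine .of_forall fun x => ?_
      simp [sysTerm_inl, bathTerm, wave_sector_inl_ne _ _ _ hn]
  · refine .of_forall fun x => ?_
    rcases n with _ | n
    · simp [sysTerm_inr, bathTerm, wave_sector_inr_zero, Matrix.mulVec, dotProduct]
    · simp [sysTerm_inr, bathTerm, wave_sector_inr_ne]

/-- The one-boson wave function `conj g` of a boson in the reservoir `i`. -/
def formFactorFun (i : Fin N) (x : Fin 1 → Mode N) : ℂ :=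
  if (x 0).1 = i then conj (g (x 0).2) else 0

theorem measurePreserving_eval_zero (N : ℕ) :
    MeasurePreserving (fun x : Fin 1 → Mode N => x 0) (confMeasure N 1) (modeMeasure N) :=
  measurePreserving_funUnique (modeMeasure N) (Fin 1)

variable {g}

theorem memLp_formFactorFun (hg : MemLp g 2 volume) (i : Fin N) :
    MemLp (formFactorFun g i) 2 (confMeasure N 1) := by
  have h1 : MemLp (fun p : Mode N => if p.1 = i then conj (g p.2) else 0) 2 (modeMeasure N) := by
    have hm : AEStronglyMeasurable (fun p : Mode N => if p.1 = i then conj (g p.2) else 0)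
        (modeMeasure N) := by
      have h2 : AEStronglyMeasurable (fun p : Mode N => conj (g p.2)) (modeMeasure N) :=
        Complex.continuous_conj.comp_aestronglyMeasurable hg.1.comp_snd
      have h3 := h2.indicator (s := {p : Mode N | p.1 = i})
        (measurable_fst (measurableSet_singleton i))
      exact h3.congr (.of_forall fun p => by simp [Set.indicator_apply])
    rw [memLp_two_iff_integrable_sq_norm hm]
    have h4 : Integrable (fun p : Mode N => (if p.1 = i then (1 : ℝ) else 0) * ‖g p.2‖ ^ 2)
        (modeMeasure N) :=
      Integrable.mul_prod (f := fun j : Fin N => if j = i then (1 : ℝ) else 0)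
        (Integrable.of_finite) ((memLp_two_iff_integrable_sq_norm hg.1).1 hg)
    refine h4.congr (.of_forall fun p => ?_)
    by_cases hp : p.1 = i <;> simp [hp]
  exact h1.comp_measurePreserving (measurePreserving_eval_zero N)

/-- The one-boson state `∫ conj (g k) b†_{k,i} dk |Ω⟩`. -/
def formFactor (hg : MemLp g 2 volume) (i : Fin N) : OneBoson N := (memLp_formFactorFun hg i).toLp

theorem integral_conf_one {F : (Fin 1 → Mode N) → ℂ} (hF : Integrable F (confMeasure N 1)) :
    ∫ x, F x ∂confMeasure N 1 = ∑ i, ∫ k : ℝ, F fun _ => (i, k) := by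
  have e := (measurePreserving_funUnique (modeMeasure N) (Fin 1)).symm
  refine (e.integral_comp (MeasurableEquiv.measurableEmbedding _) F).symm.trans ?_
  have h2 := e.integrable_comp_of_integrable hF
  rw [modeMeasure] at h2 ⊢
  exact (integral_prod _ h2).trans (integral_count _)

/-- The conjugate in the form factor cancels the one in the inner product; the result is exactly the
annihilation term of the Hamiltonian on one boson. -/
theorem inner_formFactor (hg : MemLp g 2 volume) (i : Fin N) (φ : OneBoson N) :
    inner ℂ (formFactor hg i) φ = ∫ k : ℝ, g k * φ fun _ => (i, k) := by
  have h1 : (fun x => inner ℂ (formFactor hg i x) (φ x)) =ᵐ[confMeasure N 1]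
      fun x => (if (x 0).1 = i then g (x 0).2 else 0) * φ x := by
    filter_upwards [(memLp_formFactorFun hg i).coeFn_toLp] with x hx
    rw [formFactor, hx, formFactorFun, RCLike.inner_apply]
    split_ifs <;> simp [mul_comm]
  rw [L2.inner_def, integral_congr_ae h1,
    integral_conf_one ((integrable_congr h1).1 (L2.integrable_inner _ _)),
    Finset.sum_eq_single i]
  · simp
  · intro j _ hj
    simp [hj]
  · simp

/-- The interaction only exchanges an excited level without bosons for the ground level with one
boson, where the factors `√(n+1)` equal `1`. The free part is kept as a separate summand, since it
cancels in the interaction picture. -/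
theorem fullHam_sector (hg : MemLp g 2 volume) (c : Fin N → ℂ) {φ ψ : OneBoson N}
    (h : ψ =ᵐ[confMeasure N 1] fun x => (ω (x 0).2 : ℂ) * φ x) :
    fullHam HS ω g (sector N (c, φ)) (sector N (HS *ᵥ c, ψ) +
      sector N (fun i => inner ℂ (formFactor hg i) φ, ∑ i, c i • formFactor hg i)) := by
  rw [← map_add, Prod.mk_add_mk]
  refine ⟨finitelyManyBosons_sector c φ, fun j n => ?_⟩
  rcases j with u | i
  · rcases n with _ | _ | n
    · refine .of_forall fun x => ?_
      simp [sysTerm_inl, bathTerm, wave_sector_inl_ne, intTerm]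
    · have h2 : ∀ᵐ x ∂confMeasure N 1, ∀ i, formFactor hg i x = formFactorFun g i x :=
        ae_all_iff.2 fun i => (memLp_formFactorFun hg i).coeFn_toLp
      have h3 : ⇑(∑ i, c i • formFactor hg i : OneBoson N) =ᵐ[confMeasure N 1]
          fun x => ∑ i, c i * formFactor hg i x := by
        refine (Lp.coeFn_finsetSum _ _).trans ?_
        have h4 : ∀ᵐ x ∂confMeasure N 1, ∀ i, (c i • formFactor hg i : OneBoson N) x =
            c i * formFactor hg i x :=
          ae_all_iff.2 fun i => Lp.coeFn_smul (c i) (formFactor hg i)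
        filter_upwards [h4] with x hx
        simp [hx]
      filter_upwards [h, h2, h3, Lp.coeFn_add ψ (∑ i, c i • formFactor hg i)] with x hx h2 h3 hs
      rw [wave_sector_inl_one, hs, Pi.add_apply, h3]
      simp [sysTerm_inl, bathTerm, wave_sector_inl_one, hx, intTerm, wave_sector_inr_zero, h2,
        formFactorFun, mul_comm]
    · refine .of_forall fun x => ?_
      simp [sysTerm_inl, bathTerm, wave_sector_inl_ne, intTerm, wave_sector_inr_ne]
  · refine .of_forall fun x => ?_
    rcases n with _ | n
    · have h1 : ∀ k : ℝ, (Fin.cons (α := fun _ => Mode N) (i, k) x : Fin 1 → Mode N) =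
          fun _ => (i, k) := fun k => funext fun r => by
        obtain rfl : r = 0 := Subsingleton.elim (α := Fin 1) _ _
        rfl
      simp [sysTerm_inr, bathTerm, wave_sector_inr_zero, Matrix.mulVec, dotProduct, intTerm,
        wave_sector_inl_one, inner_formFactor, h1]
    · simp [sysTerm_inr, bathTerm, wave_sector_inr_ne, intTerm, wave_sector_inl_ne]

end Hamiltonians

/-! ### Free evolution of one boson and energy cutoffs -/

section Phase

variable {N : ℕ} {ω : ℝ → ℝ}

/-- The phase `e^{-i ω t}` acquired by one boson. -/
def phaseFun (ω : ℝ → ℝ) (t : ℝ) (x : Fin 1 → Mode N) : ℂ :=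
  Complex.exp (-Complex.I * ω (x 0).2 * t)

theorem norm_phaseFun (t : ℝ) (x : Fin 1 → Mode N) : ‖phaseFun ω t x‖ = 1 := by
  simp [phaseFun, Complex.norm_exp]

theorem phaseFun_add (s t : ℝ) (x : Fin 1 → Mode N) :
    phaseFun ω (s + t) x = phaseFun ω s x * phaseFun ω t x := by
  rw [phaseFun, phaseFun, phaseFun, ← Complex.exp_add]
  congr 1; push_cast; ring

theorem measurable_energy (hω : Measurable ω) :
    Measurable fun x : Fin 1 → Mode N => ω (x 0).2 :=
  hω.comp (measurable_snd.comp (measurable_pi_apply 0))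

theorem measurable_phaseFun (hω : Measurable ω) (t : ℝ) :
    Measurable (phaseFun (N := N) ω t) :=
  Complex.measurable_exp.comp (((Complex.measurable_ofReal.comp
    (measurable_energy hω)).const_mul _).mul_const _)

theorem memLp_phaseFun_mul (hω : Measurable ω) (t : ℝ) (φ : OneBoson N) :
    MemLp (fun x => phaseFun ω t x * φ x) 2 (confMeasure N 1) :=
  (Lp.memLp φ).of_le ((measurable_phaseFun hω t).aestronglyMeasurable.mul (Lp.memLp φ).1)
    (.of_forall fun x => by rw [norm_mul, norm_phaseFun, one_mul])

/-- The free evolution of one boson. -/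
def phase (hω : Measurable ω) (t : ℝ) : OneBoson N →ₗᵢ[ℂ] OneBoson N where
  toFun φ := (memLp_phaseFun_mul hω t φ).toLp
  map_add' φ ψ := by
    refine Lp.ext ?_
    filter_upwards [(memLp_phaseFun_mul hω t (φ + ψ)).coeFn_toLp,
      (memLp_phaseFun_mul hω t φ).coeFn_toLp, (memLp_phaseFun_mul hω t ψ).coeFn_toLp,
      Lp.coeFn_add φ ψ, Lp.coeFn_add (memLp_phaseFun_mul hω t φ).toLp
        (memLp_phaseFun_mul hω t ψ).toLp] with x h1 h2 h3 h4 h5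
    rw [h1, h5, h4, Pi.add_apply, Pi.add_apply, h2, h3, mul_add]
  map_smul' c φ := by
    refine Lp.ext ?_
    filter_upwards [(memLp_phaseFun_mul hω t (c • φ)).coeFn_toLp,
      (memLp_phaseFun_mul hω t φ).coeFn_toLp,
      Lp.coeFn_smul c φ, Lp.coeFn_smul c (memLp_phaseFun_mul hω t φ).toLp] with x h1 h2 h4 h5
    rw [RingHom.id_apply, h1, h5, h4, Pi.smul_apply, Pi.smul_apply, h2, smul_eq_mul, smul_eq_mul]
    ring
  norm_map' φ := by
    change ‖(memLp_phaseFun_mul hω t φ).toLp‖ = _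
    rw [Lp.norm_toLp, Lp.norm_def]
    congr 1
    exact eLpNorm_congr_norm_ae (.of_forall fun x => by rw [norm_mul, norm_phaseFun, one_mul])

theorem coeFn_phase (hω : Measurable ω) (t : ℝ) (φ : OneBoson N) :
    phase hω t φ =ᵐ[confMeasure N 1] fun x => phaseFun ω t x * φ x :=
  (memLp_phaseFun_mul hω t φ).coeFn_toLp

theorem phase_add (hω : Measurable ω) (s t : ℝ) (φ : OneBoson N) :
    phase hω (s + t) φ = phase hω s (phase hω t φ) := by
  refine Lp.ext ?_
  filter_upwards [coeFn_phase hω (s + t) φ, coeFn_phase hω t φ,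
    coeFn_phase hω s (phase hω t φ)] with x h1 h2 h3
  rw [h1, h3, h2, phaseFun_add, mul_assoc]

theorem phase_zero (hω : Measurable ω) (φ : OneBoson N) : phase hω 0 φ = φ := by
  refine Lp.ext ?_
  filter_upwards [coeFn_phase hω 0 φ] with x h1
  simp [h1, phaseFun]

/-- The boson energies that occur in `φ` are at most `M`. -/
def EnergyLE (ω : ℝ → ℝ) (M : ℝ) (φ : OneBoson N) : Prop :=
  ∀ᵐ x ∂confMeasure N 1, M < |ω (x 0).2| → φ x = 0

theorem EnergyLE.phase {M : ℝ} {φ : OneBoson N} (h : EnergyLE ω M φ) (hω : Measurable ω) (t : ℝ) :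
    EnergyLE ω M (phase hω t φ) := by
  unfold EnergyLE at h ⊢
  filter_upwards [h, coeFn_phase hω t φ] with x h1 h2 hx
  rw [h2, h1 hx, mul_zero]

theorem EnergyLE.exists_energy_mul {M : ℝ} {φ : OneBoson N} (h : EnergyLE ω M φ)
    (hω : Measurable ω) :
    ∃ ψ : OneBoson N, ψ =ᵐ[confMeasure N 1] fun x => (ω (x 0).2 : ℂ) * φ x := by
  have h1 : MemLp (fun x => (ω (x 0).2 : ℂ) * φ x) 2 (confMeasure N 1) := by
    refine (Lp.memLp φ).of_le_mul (c := M) ((Complex.measurable_ofReal.comp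
      (measurable_energy hω)).aestronglyMeasurable.mul (Lp.memLp φ).1) ?_
    filter_upwards [h] with x hx
    rw [norm_mul, Complex.norm_real, Real.norm_eq_abs]
    by_cases hM : M < |ω (x 0).2|
    · simp [hx hM]
    · exact mul_le_mul_of_nonneg_right (not_lt.1 hM) (norm_nonneg _)
  exact ⟨h1.toLp, h1.coeFn_toLp⟩

theorem energy_mul_phase (hω : Measurable ω) {φ ψ : OneBoson N}
    (hψ : ψ =ᵐ[confMeasure N 1] fun x => (ω (x 0).2 : ℂ) * φ x) (t : ℝ) :
    phase hω t ψ =ᵐ[confMeasure N 1] fun x => (ω (x 0).2 : ℂ) * phase hω t φ x := by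
  filter_upwards [hψ, coeFn_phase hω t ψ, coeFn_phase hω t φ] with x h1 h2 h3
  rw [h2, h3, h1]; ring

/-- With energies bounded by `M`, the estimate `|e^z - 1 - z| ≤ |z|²` for `|z| ≤ 1` holds uniformly
over configurations and gives an error of order `(s - t)² M² ‖φ‖`. -/
theorem EnergyLE.hasDerivAt_phase {M : ℝ} {φ ψ : OneBoson N} (h : EnergyLE ω M φ)
    (hω : Measurable ω) (hψ : ψ =ᵐ[confMeasure N 1] fun x => (ω (x 0).2 : ℂ) * φ x) (t : ℝ) :
    HasDerivAt (fun t => RWA.phase hω t φ) (-Complex.I • RWA.phase hω t ψ) t := by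
  rw [hasDerivAt_iff_isLittleO]
  refine Asymptotics.IsBigO.trans_isLittleO (Asymptotics.IsBigO.of_bound (M ^ 2 * ‖φ‖) ?_)
    (Asymptotics.isLittleO_pow_sub_sub t one_lt_two)
  have h1 : ∀ᶠ s in nhds t, |s - t| * |M| < 1 := by
    have h2 : Continuous fun s : ℝ => |s - t| * |M| := by fun_prop
    exact (h2.tendsto' t 0 (by simp)).eventually_lt_const one_pos
  filter_upwards [h1] with s hs
  have h3 : ‖RWA.phase hω s φ - RWA.phase hω t φ - (s - t) • -Complex.I • RWA.phase hω t ψ‖ ≤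
      ((s - t) ^ 2 * M ^ 2) * ‖φ‖ := by
    refine Lp.norm_le_mul_norm_of_ae_le_mul ?_
    have hsm : (s - t) • -Complex.I • RWA.phase hω t ψ =
        (((s - t : ℝ) : ℂ) * -Complex.I) • RWA.phase hω t ψ := by
      rw [mul_smul, Complex.coe_smul]
      rfl
    rw [hsm]
    filter_upwards [h, hψ, coeFn_phase hω s φ, coeFn_phase hω t φ, coeFn_phase hω t ψ,
      Lp.coeFn_sub (RWA.phase hω s φ) (RWA.phase hω t φ),
      Lp.coeFn_sub (RWA.phase hω s φ - RWA.phase hω t φ)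
        ((((s - t : ℝ) : ℂ) * -Complex.I) • RWA.phase hω t ψ),
      Lp.coeFn_smul (((s - t : ℝ) : ℂ) * -Complex.I) (RWA.phase hω t ψ)]
      with x h0 h1 h2 h3 h4 h5 h6 h7
    rw [h6, Pi.sub_apply, h5, Pi.sub_apply, h7, Pi.smul_apply, h2, h3, h4, h1, smul_eq_mul]
    by_cases hM : M < |ω (x 0).2|
    · simp [h0 hM]
    · set e := ω (x 0).2
      have hsplit : phaseFun ω s x = phaseFun ω t x * Complex.exp (-Complex.I * e * (s - t : ℝ)) := by
        rw [← add_sub_cancel t s, phaseFun_add, add_sub_cancel]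
        rfl
      have hfac : phaseFun ω s x * φ x - phaseFun ω t x * φ x -
          ((s - t : ℝ) : ℂ) * -Complex.I * (phaseFun ω t x * (e * φ x)) =
          phaseFun ω t x * (Complex.exp (-Complex.I * e * (s - t : ℝ)) - 1 -
            (-Complex.I * e * (s - t : ℝ))) * φ x := by
        rw [hsplit]; ring
      have hn : ‖-Complex.I * (e : ℂ) * ((s - t : ℝ) : ℂ)‖ = |s - t| * |e| := by
        simp only [norm_mul, norm_neg, Complex.norm_I, Complex.norm_real, Real.norm_eq_abs]; ring
      have heM : |e| ≤ |M| := (not_lt.1 hM).trans (le_abs_self M)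
      have hle : |s - t| * |e| ≤ |s - t| * |M| := mul_le_mul_of_nonneg_left heM (abs_nonneg _)
      rw [hfac, norm_mul, norm_mul, norm_phaseFun, one_mul]
      refine mul_le_mul_of_nonneg_right ?_ (norm_nonneg _)
      refine (Complex.norm_exp_sub_one_sub_id_le (by rw [hn]; exact hle.trans hs.le)).trans ?_
      rw [hn, ← sq_abs (s - t), ← sq_abs M, ← mul_pow]
      exact pow_le_pow_left₀ (by positivity) hle 2
  refine h3.trans (le_of_eq ?_)
  rw [norm_pow, norm_norm, Real.norm_eq_abs, sq_abs]
  ring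

/-- Wave functions with bounded boson energies are dense. -/
theorem exists_seq_energyLE (hω : Measurable ω) (φ : OneBoson N) :
    ∃ u : ℕ → OneBoson N, (∀ n : ℕ, EnergyLE ω n (u n)) ∧
      Filter.Tendsto u Filter.atTop (nhds φ) := by
  set S : ℕ → Set (Fin 1 → Mode N) := fun n => {x | |ω (x 0).2| ≤ n} with hS
  have hSm : ∀ n, MeasurableSet (S n) := fun n =>
    measurableSet_le (measurable_energy hω).abs measurable_const
  have hm : ∀ n, MemLp ((S n).indicator φ) 2 (confMeasure N 1) := fun n =>
    (Lp.memLp φ).indicator (hSm n)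
  refine ⟨fun n => (hm n).toLp, fun n => ?_, ?_⟩
  · unfold EnergyLE
    filter_upwards [(hm n).coeFn_toLp] with x hx hlt
    rw [hx, Set.indicator_of_notMem]
    simpa [hS] using hlt
  · rw [tendsto_iff_norm_sub_tendsto_zero]
    -- The squared norm is an integral dominated by `‖φ x‖²`, and at each point the cutoff is
    -- eventually inactive.
    have hsq : Filter.Tendsto (fun n => ‖(hm n).toLp - φ‖ ^ 2) Filter.atTop (nhds 0) := by
      have h1 : ∀ n, ((‖(hm n).toLp - φ‖ ^ 2 : ℝ) : ℂ) =
          ∫ x, inner ℂ ((S n).indicator φ x - φ x) ((S n).indicator φ x - φ x)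
            ∂confMeasure N 1 := fun n => by
        have h2 := inner_self_eq_norm_sq_to_K (𝕜 := ℂ) ((hm n).toLp - φ)
        rw [Complex.ofReal_pow]
        refine h2.symm.trans ?_
        rw [L2.inner_def]
        refine integral_congr_ae ?_
        filter_upwards [Lp.coeFn_sub (hm n).toLp φ, (hm n).coeFn_toLp] with x h3 h4
        rw [h3, Pi.sub_apply, h4]
      have h5 : Filter.Tendsto (fun n => ∫ x, inner ℂ ((S n).indicator φ x - φ x)
          ((S n).indicator φ x - φ x) ∂confMeasure N 1) Filter.atTop
          (nhds (∫ _, (0 : ℂ) ∂confMeasure N 1)) := by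
        refine tendsto_integral_of_dominated_convergence (fun x => ‖φ x‖ ^ 2) (fun n => ?_)
          ((memLp_two_iff_integrable_sq_norm (Lp.memLp φ).1).1 (Lp.memLp φ)) (fun n => ?_) ?_
        · exact ((hm n).1.sub (Lp.memLp φ).1).inner ((hm n).1.sub (Lp.memLp φ).1)
        · refine .of_forall fun x => ?_
          by_cases hx : x ∈ S n
          · simp [hx]
          · simp [hx]
        · refine .of_forall fun x => ?_
          obtain ⟨m, hmx⟩ := exists_nat_ge |ω (x 0).2|
          refine tendsto_const_nhds.congr' ?_
          filter_upwards [Filter.eventually_ge_atTop m] with n hn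
          have : x ∈ S n := hmx.trans (by exact_mod_cast hn)
          simp [this]
      rw [integral_zero] at h5
      have h6 := (Complex.continuous_re.tendsto 0).comp h5
      rw [Complex.zero_re] at h6
      exact h6.congr fun n => by rw [Function.comp_apply, ← h1, Complex.ofReal_re]
    have h7 := hsq.sqrt
    simpa using h7

variable {g : ℝ → ℂ}

theorem inner_formFactor_phase (hω : Measurable ω) (hg : MemLp g 2 volume) (i j : Fin N) (t : ℝ) :
    inner ℂ (formFactor hg i) (phase hω t (formFactor hg j)) =
      if i = j then bathCorr ω g t else 0 := by
  have h1 : (fun x => inner ℂ (formFactor hg i x) (phase hω t (formFactor hg j) x))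
      =ᵐ[confMeasure N 1] fun x => if (x 0).1 = i then (if i = j then
        ((‖g (x 0).2‖ ^ 2 : ℝ) : ℂ) * Complex.exp (-Complex.I * ω (x 0).2 * t) else 0) else 0 := by
    filter_upwards [(memLp_formFactorFun hg i).coeFn_toLp, coeFn_phase hω t (formFactor hg j),
      (memLp_formFactorFun hg j).coeFn_toLp] with x h1 h2 h3
    rw [h2, formFactor, formFactor, h1, h3, formFactorFun, formFactorFun, RCLike.inner_apply,
      phaseFun]
    by_cases hi : (x 0).1 = i
    · by_cases hij : i = j
      · subst hij
        rw [if_pos hi, if_pos hi, if_pos rfl, RCLike.conj_conj, mul_assoc, RCLike.conj_mul,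
          mul_comm]
        simp
      · have hj : (x 0).1 ≠ j := fun h => hij (hi.symm.trans h)
        simp [hj, hij]
    · simp [hi]
  rw [L2.inner_def, integral_congr_ae h1,
    integral_conf_one ((integrable_congr h1).1 (L2.integrable_inner _ _)),
    Finset.sum_eq_single i]
  · split_ifs <;> simp [bathCorr]
  · intro k _ hk
    simp [hk]
  · simp

theorem continuous_bathCorr (hω : Measurable ω) (hg : MemLp g 2 volume) :
    Continuous (bathCorr ω g) := by
  have hi := (memLp_two_iff_integrable_sq_norm hg.1).1 hg
  refine continuous_of_dominated (bound := fun k => ‖g k‖ ^ 2) (fun t => ?_) (fun t => ?_) hi ?_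
  · refine (Complex.continuous_ofReal.comp_aestronglyMeasurable hi.1).mul ?_
    exact (Complex.measurable_exp.comp (((Complex.measurable_ofReal.comp
      hω).const_mul _).mul_const _)).aestronglyMeasurable
  · refine .of_forall fun k => ?_
    simp [Complex.norm_exp]
  · refine .of_forall fun k => ?_
    fun_prop

end Phase

/-! ### Dynamics of the sector under both groups -/

section SectorDynamics

variable {N : ℕ} {HS : Matrix (Fin N) (Fin N) ℂ} {ω : ℝ → ℝ} {g : ℝ → ℂ}
  {U₀ U : ℝ → Total N ≃ₗᵢ[ℂ] Total N} {V : ℝ → Matrix (Fin N) (Fin N) ℂ}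

theorem hasDerivAt_sector {c : ℝ → Fin N → ℂ} {φ : ℝ → OneBoson N} {c' : Fin N → ℂ}
    {φ' : OneBoson N} {t : ℝ} (hc : HasDerivAt c c' t) (hφ : HasDerivAt φ φ' t) :
    HasDerivAt (fun s => sector N (c s, φ s)) (sector N (c', φ')) t :=
  ((sector N).restrictScalars ℝ).hasFDerivAt.comp_hasDerivAt t (hc.prodMk hφ)

theorem hasDerivAt_free_sector (hω : Measurable ω) (c : Fin N → ℂ) {M : ℝ} {φ ψ : OneBoson N}
    (hM : EnergyLE ω M φ) (hψ : ψ =ᵐ[confMeasure N 1] fun x => (ω (x 0).2 : ℂ) * φ x) (t : ℝ) :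
    HasDerivAt (fun t => sector N (matrixGroup HS t *ᵥ c, phase hω t φ))
      (-Complex.I • sector N (HS *ᵥ (matrixGroup HS t *ᵥ c), phase hω t ψ)) t := by
  rw [← map_smul, Prod.smul_mk]
  exact hasDerivAt_sector (hasDerivAt_matrixGroup_mulVec HS c t) (hM.hasDerivAt_phase hω hψ t)

/-- For bounded energies the right-hand side solves the Schrödinger equation inside the domain, so
uniqueness applies; density of such states and continuity give the rest. -/
theorem free_apply_sector (hω : Measurable ω) (hU₀ : IsUnitaryGroup (freeHam HS ω) U₀) (t : ℝ)
    (c : Fin N → ℂ) (φ : OneBoson N) :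
    U₀ t (sector N (c, φ)) = sector N (matrixGroup HS t *ᵥ c, phase hω t φ) := by
  obtain ⟨u, hu, hlim⟩ := exists_seq_energyLE hω φ
  have h1 : ∀ n, U₀ t (sector N (c, u n)) =
      sector N (matrixGroup HS t *ᵥ c, phase hω t (u n)) := fun n => by
    obtain ⟨ψ, hψ⟩ := (hu n).exists_energy_mul hω
    have := hU₀.apply_eq (fun s => hasDerivAt_free_sector hω c (hu n) hψ s)
      (fun s => freeHam_sector HS _ (energy_mul_phase hω hψ s)) t
    simpa [matrixGroup_zero, phase_zero] using this
  have h2 : Filter.Tendsto (fun n => U₀ t (sector N (c, u n))) Filter.atTop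
      (nhds (U₀ t (sector N (c, φ)))) :=
    ((U₀ t).continuous.tendsto _).comp (((sector N).continuous.tendsto _).comp
      (tendsto_const_nhds.prodMk_nhds hlim))
  have h3 : Filter.Tendsto (fun n => sector N (matrixGroup HS t *ᵥ c, phase hω t (u n)))
      Filter.atTop (nhds (sector N (matrixGroup HS t *ᵥ c, phase hω t φ))) :=
    ((sector N).continuous.tendsto _).comp (tendsto_const_nhds.prodMk_nhds
      (((phase hω t).continuous.tendsto _).comp hlim))
  simp only [h1] at h2
  exact tendsto_nhds_unique h2 h3

theorem norm_sector_zero_left (φ : OneBoson N) : ‖sector N (0, φ)‖ = ‖φ‖ := by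
  have h : ‖sector N (0, φ)‖ ^ 2 = ‖φ‖ ^ 2 := by
    rw [PiLp.norm_sq_eq_of_L2, Fintype.sum_sum_type]
    simp [sector_inl, sector_inr, norm_oneBosonFock]
  exact (sq_eq_sq₀ (norm_nonneg _) (norm_nonneg _)).1 h

/-- Strong continuity is inherited from `U₀` through the isometric embedding `φ ↦ (0, φ)` into the
sector. -/
theorem continuous_phase (hω : Measurable ω) (hU₀ : IsUnitaryGroup (freeHam HS ω) U₀)
    (φ : OneBoson N) : Continuous fun t => phase hω t φ := by
  have h1 : Isometry fun φ : OneBoson N => sector N (0, φ) := by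
    refine Isometry.of_dist_eq fun φ ψ => ?_
    rw [dist_eq_norm, dist_eq_norm, ← map_sub, Prod.mk_sub_mk, sub_zero, norm_sector_zero_left]
  rw [h1.isEmbedding.continuous_iff]
  refine (hU₀.continuous (sector N (0, φ))).congr fun t => ?_
  rw [free_apply_sector hω hU₀, Matrix.mulVec_zero]
  rfl

/-- The interaction maps the sector `(c, φ)` to `(⟨f i, φ⟩, ∑ i, c i f i)`, where the `f i` are the
form factors. -/
theorem hasDerivAt_wave_operator_of_energyLE (hω : Measurable ω) (hg : MemLp g 2 volume)
    (hU₀ : IsUnitaryGroup (freeHam HS ω) U₀) (hU : IsUnitaryGroup (fullHam HS ω g) U)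
    (c : Fin N → ℂ) {M : ℝ} {φ : OneBoson N} (hM : EnergyLE ω M φ) (t : ℝ) :
    HasDerivAt (fun s => U (-s) (U₀ s (sector N (c, φ))))
      (Complex.I • U (-t) (sector N (fun i => inner ℂ (formFactor hg i) (phase hω t φ),
        ∑ i, (matrixGroup HS t *ᵥ c) i • formFactor hg i))) t := by
  obtain ⟨ψ, hψ⟩ := hM.exists_energy_mul hω
  simp only [free_apply_sector hω hU₀]
  have h1 := (hU.hasDerivAt_apply_neg (fullHam_sector HS ω hg (matrixGroup HS t *ᵥ c)
    (energy_mul_phase hω hψ t)) t).hasDerivWithinAt (s := Set.univ)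
  have h2 := hasDerivWithinAt_unitary_apply hU.continuous_apply_neg
    (hasDerivAt_free_sector (HS := HS) hω c hM hψ t).hasDerivWithinAt h1
  -- The free part of the full Hamiltonian cancels the derivative of the free evolution; only the
  -- interaction survives.
  refine (h2.hasDerivAt Filter.univ_mem).congr_deriv ?_
  rw [map_add, map_smul, smul_add, neg_smul]
  abel

/-- The derivative depends on `φ` only through bounded functionals composed with isometries. Along
cutoffs of `φ` it therefore converges uniformly in time, and the energy bound can be dropped. -/
theorem hasDerivAt_wave_operator (hω : Measurable ω) (hg : MemLp g 2 volume)
    (hU₀ : IsUnitaryGroup (freeHam HS ω) U₀) (hU : IsUnitaryGroup (fullHam HS ω g) U)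
    (c : Fin N → ℂ) (φ : OneBoson N) (t : ℝ) :
    HasDerivAt (fun s => U (-s) (U₀ s (sector N (c, φ))))
      (Complex.I • U (-t) (sector N (fun i => inner ℂ (formFactor hg i) (phase hω t φ),
        ∑ i, (matrixGroup HS t *ᵥ c) i • formFactor hg i))) t := by
  obtain ⟨u, hu, hlim⟩ := exists_seq_energyLE hω φ
  -- `B` is the absorption part of the interaction; emission does not involve `φ` and drops out of
  -- the differences.
  let B : OneBoson N →L[ℂ] Total N := sector N ∘L
    (ContinuousLinearMap.inl ℂ (Fin N → ℂ) (OneBoson N)) ∘L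
      ContinuousLinearMap.pi fun i => innerSL ℂ (formFactor hg i)
  refine hasDerivAt_of_tendstoUniformly (l := Filter.atTop)
    (f := fun (n : ℕ) s => U (-s) (U₀ s (sector N (c, u n))))
    (f' := fun n t => Complex.I • U (-t) (sector N
      (fun i => inner ℂ (formFactor hg i) (phase hω t (u n)),
        ∑ i, (matrixGroup HS t *ᵥ c) i • formFactor hg i)))
    (g' := fun t => Complex.I • U (-t) (sector N
      (fun i => inner ℂ (formFactor hg i) (phase hω t φ),
        ∑ i, (matrixGroup HS t *ᵥ c) i • formFactor hg i))) ?_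
    (.of_forall fun n s => hasDerivAt_wave_operator_of_energyLE hω hg hU₀ hU c (hu n) s)
    (fun s => ?_) t
  · rw [Metric.tendstoUniformly_iff]
    intro ε hε
    have h1 : Filter.Tendsto (fun n => ‖B‖ * ‖φ - u n‖) Filter.atTop (nhds 0) := by
      have h2 : Filter.Tendsto (fun n => φ - u n) Filter.atTop (nhds 0) := by
        simpa using (tendsto_const_nhds (x := φ)).sub hlim
      simpa using h2.norm.const_mul ‖B‖
    filter_upwards [h1.eventually_lt_const hε] with n hn s
    refine lt_of_le_of_lt ?_ hn
    rw [dist_eq_norm, ← smul_sub, ← map_sub, ← map_sub, norm_smul, Complex.norm_I, one_mul,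
      LinearIsometryEquiv.norm_map, Prod.mk_sub_mk, sub_self]
    have h3 : sector N ((fun i => inner ℂ (formFactor hg i) (phase hω s φ)) -
        fun i => inner ℂ (formFactor hg i) (phase hω s (u n)), 0) =
        B (phase hω s (φ - u n)) := by
      have hB : ∀ x, B x = sector N (fun i => inner ℂ (formFactor hg i) x, 0) := fun _ => rfl
      rw [map_sub, hB]
      congr 2
      funext i
      rw [Pi.sub_apply, inner_sub_right]
    rw [h3]
    refine (B.le_opNorm _).trans (le_of_eq ?_)
    rw [LinearIsometry.norm_map]
  · exact ((U (-s)).continuous.tendsto _).comp (((U₀ s).continuous.tendsto _).comp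
      (((sector N).continuous.tendsto _).comp (tendsto_const_nhds.prodMk_nhds hlim)))

/-- In the interaction picture an excitation `c` of the system evolves to `V t c`, up to a state in
which the excitation is a boson. -/
theorem exists_intProp_zero_sector (hω : Measurable ω) (hg : MemLp g 2 volume)
    (hU₀ : IsUnitaryGroup (freeHam HS ω) U₀) (hU : IsUnitaryGroup (fullHam HS ω g) U)
    (hV : IsPropagator HS (bathCorr ω g) V) (c : Fin N → ℂ) {t : ℝ} (ht : 0 ≤ t) :
    ∃ φ, U₀ (-t) (U t (sector N (c, 0))) = sector N (V t *ᵥ c, φ) :=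
  exists_interaction_picture_eq hU₀ hU (sector N) (phase hω) (continuous_phase hω hU₀)
    (phase_add hω) (phase_zero hω) (free_apply_sector hω hU₀) (formFactor hg)
    (continuous_bathCorr hω hg) (inner_formFactor_phase hω hg)
    (hasDerivAt_wave_operator hω hg hU₀ hU) hV c ht

theorem vacuum_ne_zero (N : ℕ) : vacuum N ≠ 0 := by
  rw [← norm_ne_zero_iff, norm_vacuum]; exact one_ne_zero

theorem sector_injective_left {c c' : Fin N → ℂ} {φ φ' : OneBoson N}
    (h : sector N (c, φ) = sector N (c', φ')) : c = c' := by
  funext i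
  have h1 : sector N (c, φ) (Sum.inr i) = sector N (c', φ') (Sum.inr i) := by rw [h]
  rw [sector_inr, sector_inr] at h1
  exact smul_left_injective ℂ (vacuum_ne_zero N) h1

/-- The propagator commutes with the free evolution of the system. -/
theorem propagator_conj_matrixGroup (hω : Measurable ω) (hg : MemLp g 2 volume)
    (hU₀ : IsUnitaryGroup (freeHam HS ω) U₀) (hU : IsUnitaryGroup (fullHam HS ω g) U)
    (hV : IsPropagator HS (bathCorr ω g) V) {t : ℝ} (ht : 0 ≤ t) (a : ℝ) (c : Fin N → ℂ) :
    matrixGroup HS (-a) *ᵥ (V t *ᵥ (matrixGroup HS a *ᵥ c)) = V t *ᵥ c := by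
  obtain ⟨φ, hφ⟩ := exists_intProp_zero_sector hω hg hU₀ hU hV c ht
  -- Both solutions of the memory equation give the system component of one and the same vector, so
  -- the dynamics itself supplies the uniqueness.
  obtain ⟨φ', hφ'⟩ := exists_intProp_zero_sector hω hg hU₀ hU
    (hV.conj (continuous_bathCorr hω hg) a) c ht
  have := sector_injective_left (hφ'.symm.trans hφ)
  rwa [← Matrix.mulVec_mulVec, ← Matrix.mulVec_mulVec] at this

/-- The propagator from `t₁` is the one from `0` over the elapsed time, conjugated by `U₀ t₁`; this
conjugation does not change `V`. -/
theorem exists_intProp_sector (hω : Measurable ω) (hg : MemLp g 2 volume)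
    (hU₀ : IsUnitaryGroup (freeHam HS ω) U₀) (hU : IsUnitaryGroup (fullHam HS ω g) U)
    (hV : IsPropagator HS (bathCorr ω g) V) (c : Fin N → ℂ) {t₁ t₂ : ℝ} (ht : t₁ ≤ t₂) :
    ∃ φ, intProp U₀ U t₁ t₂ (sector N (c, 0)) = sector N (V (t₂ - t₁) *ᵥ c, φ) := by
  obtain ⟨φ, hφ⟩ := exists_intProp_zero_sector hω hg hU₀ hU hV (matrixGroup HS t₁ *ᵥ c)
    (sub_nonneg.2 ht)
  refine ⟨phase hω (-t₁) φ, ?_⟩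
  rw [intProp, LinearIsometryEquiv.trans_apply, LinearIsometryEquiv.trans_apply,
    free_apply_sector hω hU₀, map_zero, show -t₂ = -t₁ + -(t₂ - t₁) by ring, hU₀.map_add, hφ,
    free_apply_sector hω hU₀,
    propagator_conj_matrixGroup hω hg hU₀ hU hV (sub_nonneg.2 ht)]

theorem intProp_ket_vacuum (hU₀ : IsUnitaryGroup (freeHam HS ω) U₀)
    (hU : IsUnitaryGroup (fullHam HS ω g) U) (t₁ t₂ : ℝ) :
    intProp U₀ U t₁ t₂ (ket (Sum.inl ()) (vacuum N)) = ket (Sum.inl ()) (vacuum N) := by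
  have h0 := hU₀.apply_eq_self (freeHam_ket_vacuum HS ω)
  have h := hU.apply_eq_self (fullHam_ket_vacuum HS ω g)
  simp [intProp, h0, h]

end SectorDynamics

/-! ### Amplitude damping channels -/

section Channel

variable {N : ℕ}

/-- The operator `1 ⊕ A` on the system. -/
def extend (A : Matrix (Fin N) (Fin N) ℂ) : SysOp N := Matrix.fromBlocks 1 0 0 A

theorem extend_mul (A B : Matrix (Fin N) (Fin N) ℂ) : extend (A * B) = extend A * extend B := by
  simp [extend, Matrix.fromBlocks_multiply]

theorem extend_one : extend (1 : Matrix (Fin N) (Fin N) ℂ) = 1 := by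
  simp [extend, Matrix.fromBlocks_one]

theorem groundState_eq : groundState N = Matrix.fromBlocks 1 0 0 0 := by
  ext (i | i) (j | j) <;> simp [groundState]

theorem trace_groundState : (groundState N).trace = 1 := by
  simp [groundState_eq, Matrix.trace, Fintype.sum_sum_type]

/-- The amplitude damping channel with amplitudes `W`. -/
def channel (W : SysOp N) : SysOp N →ₗ[ℂ] SysOp N where
  toFun ρ := W * ρ * Wᴴ + (ρ.trace - (W * ρ * Wᴴ).trace) • groundState N
  map_add' ρ ρ' := by
    simp only [mul_add, add_mul, Matrix.trace_add]
    module
  map_smul' c ρ := by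
    simp only [Matrix.mul_smul, Matrix.smul_mul, Matrix.trace_smul, RingHom.id_apply, smul_eq_mul]
    module

theorem channel_apply (W ρ : SysOp N) :
    channel W ρ = W * ρ * Wᴴ + (ρ.trace - (W * ρ * Wᴴ).trace) • groundState N := rfl

theorem trace_channel (W ρ : SysOp N) : (channel W ρ).trace = ρ.trace := by
  rw [channel_apply, Matrix.trace_add, Matrix.trace_smul, trace_groundState, smul_eq_mul, mul_one,
    add_sub_cancel]

theorem channel_one (ρ : SysOp N) : channel 1 ρ = ρ := by simp [channel_apply]

theorem extend_mul_groundState (A : Matrix (Fin N) (Fin N) ℂ) :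
    extend A * groundState N * (extend A)ᴴ = groundState N := by
  simp [extend, groundState_eq, Matrix.fromBlocks_multiply, Matrix.fromBlocks_conjTranspose]

theorem channel_groundState (A : Matrix (Fin N) (Fin N) ℂ) :
    channel (extend A) (groundState N) = groundState N := by
  rw [channel_apply, extend_mul_groundState, sub_self, zero_smul, add_zero]

/-- Population already moved to the ground state stays there, and the trace is preserved, so the two
losses add up to the loss of the product. -/
theorem channel_channel (A B : Matrix (Fin N) (Fin N) ℂ) (ρ : SysOp N) :
    channel (extend A) (channel (extend B) ρ) = channel (extend (A * B)) ρ := by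
  have h1 : extend A * channel (extend B) ρ * (extend A)ᴴ =
      extend (A * B) * ρ * (extend (A * B))ᴴ +
        (ρ.trace - (extend B * ρ * (extend B)ᴴ).trace) • groundState N := by
    rw [channel_apply, mul_add, add_mul, Matrix.mul_smul, Matrix.smul_mul, extend_mul_groundState,
      extend_mul, Matrix.conjTranspose_mul]
    simp only [mul_assoc]
  rw [channel_apply (extend A), trace_channel, h1, Matrix.trace_add, Matrix.trace_smul,
    trace_groundState, channel_apply]
  module

theorem dipole_mul_groundState (h : Fin N → ℂ) : dipole h * groundState N = dipole h := by
  rw [dipole, groundState_eq, Matrix.fromBlocks_multiply]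
  simp

theorem channel_dipole (A : Matrix (Fin N) (Fin N) ℂ) (h : Fin N → ℂ) :
    channel (extend A) (dipole h) = dipole (A *ᵥ h) := by
  have h1 : extend A * dipole h * (extend A)ᴴ = dipole (A *ᵥ h) := by
    rw [extend, dipole, dipole, Matrix.fromBlocks_conjTranspose, Matrix.fromBlocks_multiply,
      Matrix.fromBlocks_multiply]
    simp only [zero_mul, mul_zero, add_zero, zero_add, Matrix.conjTranspose_zero,
      Matrix.conjTranspose_one, mul_one, Matrix.zero_mul, Matrix.mul_zero, Matrix.mul_one]
    rfl
  have h2 : ∀ h : Fin N → ℂ, (dipole h).trace = 0 := fun h => by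
    simp [dipole, Matrix.trace, Fintype.sum_sum_type]
  rw [channel_apply, h1, h2, h2, sub_self, zero_smul, add_zero]

theorem trace_dipole_conjTranspose_mul (h h' : Fin N → ℂ) :
    ((dipole h)ᴴ * dipole h').trace = star h ⬝ᵥ h' := by
  rw [dipole, dipole, Matrix.fromBlocks_conjTranspose, Matrix.fromBlocks_multiply]
  simp [Matrix.trace, Fintype.sum_sum_type, Matrix.mul_apply, dotProduct]

section
open scoped Matrix.Norms.L2Operator MatrixOrder

/-- The density matrices span the space of all matrices. -/
theorem linearMap_ext_density {M : Type*} [AddCommGroup M] [Module ℂ M]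
    {f f' : SysOp N →ₗ[ℂ] M}
    (h : ∀ ρ : SysOp N, ρ.PosSemidef → ρ.trace = 1 → f ρ = f' ρ) : f = f' := by
  -- Positive elements span a C*-algebra; a positive matrix is zero or a multiple of a density
  -- matrix, according to its trace.
  refine LinearMap.ext_on (s := {ρ : SysOp N | 0 ≤ ρ}) CStarAlgebra.span_nonneg fun ρ hρ => ?_
  have hp : ρ.PosSemidef := Matrix.nonneg_iff_posSemidef.1 hρ
  by_cases h0 : ρ.trace = 0
  · rw [hp.trace_eq_zero_iff.1 h0, map_zero, map_zero]
  · have h1 := h ((ρ.trace)⁻¹ • ρ) (hp.smul (inv_nonneg.2 hp.trace_nonneg))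
      (by rw [Matrix.trace_smul, smul_eq_mul, inv_mul_cancel₀ h0])
    rw [map_smul, map_smul] at h1
    exact smul_right_injective M (inv_ne_zero h0) h1

end

end Channel

/-! ### Product operators as sums of rank-one operators -/

section Blocks

variable {N : ℕ}

theorem tensor_apply (A : SysOp N) (T : Fock N →L[ℂ] Fock N) (x : Total N) (i : Level N) :
    tensor A T x i = ∑ j, A i j • T (x j) := by
  simp [tensor]

theorem inner_ket (a : Level N) (x : Fock N) (Ψ : Total N) :
    inner ℂ (ket a x) Ψ = inner ℂ x (Ψ a) := by
  rw [PiLp.inner_apply, Finset.sum_eq_single a]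
  · rw [ket_apply_self]
  · intro b _ hb
    rw [ket_apply_ne hb, inner_zero_left]
  · simp

/-- The rank-one form lets unitary evolution act on vectors and turns partial traces into inner
products. -/
theorem tensor_vacuumProj (ρ : SysOp N) :
    tensor ρ (vacuumProj N) = ∑ a, ∑ b, ρ a b •
      InnerProductSpace.rankOne ℂ (ket a (vacuum N)) (ket b (vacuum N)) := by
  refine ContinuousLinearMap.ext fun x => PiLp.ext fun i => ?_
  rw [tensor_apply]
  simp only [_root_.sum_apply, _root_.smul_apply,
    InnerProductSpace.rankOne_apply, inner_ket, WithLp.ofLp_sum, WithLp.ofLp_smul,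
    Finset.sum_apply, Pi.smul_apply, vacuumProj]
  refine Eq.trans ?_ (Finset.sum_eq_single i (fun a _ ha => ?_) (by simp)).symm
  · simp only [ket_apply_self]
  · simp only [ket_apply_ne ha.symm, smul_zero, Finset.sum_const_zero]

theorem block_rankOne (x y : Total N) (i j : Level N) :
    block (InnerProductSpace.rankOne ℂ x y) i j = InnerProductSpace.rankOne ℂ (x i) (y j) := by
  refine ContinuousLinearMap.ext fun z => ?_
  have h : block (InnerProductSpace.rankOne ℂ x y) i j z = inner ℂ y (ket j z) • x i := rfl
  rw [h, InnerProductSpace.rankOne_apply, ← inner_conj_symm, inner_ket, inner_conj_symm]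

/-- `block` as a linear map. -/
def blockLinear (i j : Level N) : (Total N →L[ℂ] Total N) →ₗ[ℂ] (Fock N →L[ℂ] Fock N) where
  toFun T := block T i j
  map_add' S T := by ext1 z; simp [block]
  map_smul' c T := by ext1 z; simp [block]

/-- `conjBy` as a linear map. -/
def conjByLinear {E : Type} [NormedAddCommGroup E] [InnerProductSpace ℂ E] (U : E ≃ₗᵢ[ℂ] E) :
    (E →L[ℂ] E) →ₗ[ℂ] (E →L[ℂ] E) where
  toFun T := conjBy U T
  map_add' S T := by ext1 z; simp [conjBy]
  map_smul' c T := by ext1 z; simp [conjBy]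

theorem partialTrace_conjBy (U : Total N ≃ₗᵢ[ℂ] Total N) (ρ : SysOp N) (i j : Level N) :
    partialTrace (conjBy U (tensor ρ (vacuumProj N))) i j =
      ∑ a, ∑ b, ρ a b * inner ℂ (U (ket b (vacuum N)) j) (U (ket a (vacuum N)) i) := by
  have h : block (conjBy U (tensor ρ (vacuumProj N))) i j = ∑ a, ∑ b, ρ a b •
      InnerProductSpace.rankOne ℂ (U (ket a (vacuum N)) i) (U (ket b (vacuum N)) j) := by
    change blockLinear i j (conjByLinear U _) = _
    rw [tensor_vacuumProj]
    simp only [map_sum, map_smul]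
    simp only [conjByLinear, blockLinear, LinearMap.coe_mk, AddHom.coe_mk, conjBy_rankOne,
      block_rankOne]
  rw [partialTrace, Matrix.of_apply, h]
  exact (HasTrace.sum _ fun a _ => HasTrace.sum _ fun b _ =>
    (hasTrace_rankOne _ _).smul (ρ a b)).tr_eq

theorem sector_single (i : Fin N) :
    sector N (Pi.single i 1, 0) = ket (Sum.inr i) (vacuum N) := by
  refine PiLp.ext fun j => ?_
  rcases j with u | j
  · rw [sector_inl, map_zero, ket_apply_ne (by simp)]
  · rw [sector_inr]
    by_cases h : j = i
    · subst h; rw [Pi.single_eq_same, one_smul, ket_apply_self]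
    · rw [Pi.single_eq_of_ne h, zero_smul, ket_apply_ne (by simpa using h)]

theorem inner_vacuum_vacuum : inner ℂ (vacuum N) (vacuum N) = (1 : ℂ) := by
  rw [inner_self_eq_norm_sq_to_K, norm_vacuum]; simp

theorem tensor_groundState_vacuumProj :
    tensor (groundState N) (vacuumProj N) = InnerProductSpace.rankOne ℂ
      (ket (Sum.inl ()) (vacuum N)) (ket (Sum.inl ()) (vacuum N)) := by
  refine ContinuousLinearMap.ext fun x => PiLp.ext fun i => ?_
  rw [tensor_apply, InnerProductSpace.rankOne_apply, inner_ket, PiLp.smul_apply, groundState_eq,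
    Fintype.sum_sum_type]
  rcases i with ⟨⟩ | i
  · simp [ket_apply_self, vacuumProj]
  · rw [ket_apply_ne (by simp)]
    simp

theorem tensor_dipole_ket_vacuum (h : Fin N → ℂ) :
    tensor (dipole h) 1 (ket (Sum.inl ()) (vacuum N)) = sector N (h, 0) := by
  refine PiLp.ext fun i => ?_
  rw [tensor_apply, Finset.sum_eq_single (Sum.inl ()) (fun b _ hb => by
    rw [ket_apply_ne hb, map_zero, smul_zero]) (fun h => (h (Finset.mem_univ _)).elim),
    ket_apply_self]
  rcases i with u | i
  · rw [sector_inl]; simp [dipole]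
  · rw [sector_inr]; simp [dipole]

theorem inner_ket_tensor_dipole_sector (h c : Fin N → ℂ) (φ : OneBoson N) :
    inner ℂ (ket (Sum.inl ()) (vacuum N)) (tensor (dipole h)ᴴ 1 (sector N (c, φ))) =
      star h ⬝ᵥ c := by
  rw [inner_ket, tensor_apply, Fintype.sum_sum_type]
  simp [sector_inl, sector_inr, dipole, dotProduct, norm_vacuum]

end Blocks

/-! ### Reduced dynamics and the two correlation functions -/

section Correlations

variable {N : ℕ} {HS : Matrix (Fin N) (Fin N) ℂ} {ω : ℝ → ℝ} {g : ℝ → ℂ}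
  {U₀ U : ℝ → Total N ≃ₗᵢ[ℂ] Total N} {V : ℝ → Matrix (Fin N) (Fin N) ℂ}

theorem exists_intProp_ket (hω : Measurable ω) (hg : MemLp g 2 volume)
    (hU₀ : IsUnitaryGroup (freeHam HS ω) U₀) (hU : IsUnitaryGroup (fullHam HS ω g) U)
    (hV : IsPropagator HS (bathCorr ω g) V) {t : ℝ} (ht : 0 ≤ t) (a : Level N) :
    ∃ χ : OneBoson N, ∀ i, intProp U₀ U 0 t (ket a (vacuum N)) i =
      extend (V t) i a • vacuum N + if i = Sum.inl () then oneBosonFock N χ else 0 := by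
  rcases a with ⟨⟩ | a
  · refine ⟨0, fun i => ?_⟩
    rw [intProp_ket_vacuum hU₀ hU]
    rcases i with ⟨⟩ | i
    · simp [ket_apply_self, extend]
    · rw [ket_apply_ne (by simp)]
      simp [extend]
  · obtain ⟨φ, hφ⟩ := exists_intProp_sector hω hg hU₀ hU hV (Pi.single a 1) ht
    refine ⟨φ, fun i => ?_⟩
    rw [← sector_single, hφ]
    rcases i with ⟨⟩ | i
    · simp [sector_inl, extend]
    · simp [sector_inr, extend]

/-- The vacuum components give `W ρ Wᴴ`. The one-boson components occur only with the system in its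
ground state, and their total weight is forced by unitarity. -/
theorem reducedState_eq (hω : Measurable ω) (hg : MemLp g 2 volume)
    (hU₀ : IsUnitaryGroup (freeHam HS ω) U₀) (hU : IsUnitaryGroup (fullHam HS ω g) U)
    (hV : IsPropagator HS (bathCorr ω g) V) {t : ℝ} (ht : 0 ≤ t) (ρ : SysOp N) :
    reducedState U₀ U t ρ = channel (extend (V t)) ρ := by
  choose χ hχ using exists_intProp_ket hω hg hU₀ hU hV ht
  set W := extend (V t)
  have hin : ∀ a b i j, inner ℂ (intProp U₀ U 0 t (ket b (vacuum N)) j)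
      (intProp U₀ U 0 t (ket a (vacuum N)) i) = conj (W j b) * W i a +
        if i = Sum.inl () ∧ j = Sum.inl () then inner ℂ (oneBosonFock N (χ b))
          (oneBosonFock N (χ a)) else 0 := fun a b i j => by
    rw [hχ, hχ, inner_add_left, inner_add_right, inner_add_right, inner_smul_left,
      inner_smul_left, inner_smul_right, inner_vacuum_vacuum]
    by_cases hi : i = Sum.inl () <;> by_cases hj : j = Sum.inl () <;>
      simp [hi, hj, inner_smul_right, inner_vacuum_oneBosonFock, inner_oneBosonFock_vacuum]
  -- The evolved kets remain orthonormal, so the Gram matrix of the emitted bosons is `1 - WᴴW`;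
  -- their explicit form is not needed.
  have hunit : ∀ a b, inner ℂ (oneBosonFock N (χ b)) (oneBosonFock N (χ a)) =
      (if a = b then 1 else 0) - ∑ k, conj (W k b) * W k a := fun a b => by
    have h1 := (intProp U₀ U 0 t).inner_map_map (ket b (vacuum N)) (ket a (vacuum N))
    rw [inner_ket, PiLp.inner_apply] at h1
    have h2 : (inner ℂ (vacuum N) (ket a (vacuum N) b) : ℂ) = if a = b then 1 else 0 := by
      by_cases hab : a = b
      · subst hab; rw [ket_apply_self, inner_vacuum_vacuum, if_pos rfl]
      · rw [ket_apply_ne (Ne.symm hab)]; simp [hab]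
    simp only [hin, and_self, Finset.sum_add_distrib, Finset.sum_ite_eq', Finset.mem_univ,
      if_true] at h1
    rw [← h2, ← h1, add_sub_cancel_left]
  ext i j
  rw [reducedState, stateDyn, partialTrace_conjBy, channel_apply]
  have h3 : ∀ i j, (W * ρ * Wᴴ) i j = ∑ a, ∑ b, ρ a b * (conj (W j b) * W i a) := fun i j => by
    rw [Matrix.mul_apply, Finset.sum_comm]
    refine Finset.sum_congr rfl fun b _ => ?_
    rw [Matrix.mul_apply, Finset.sum_mul]
    refine Finset.sum_congr rfl fun a _ => ?_
    rw [Matrix.conjTranspose_apply, RCLike.star_def]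
    ring
  have h4 : ρ.trace - (W * ρ * Wᴴ).trace =
      ∑ a, ∑ b, ρ a b * inner ℂ (oneBosonFock N (χ b)) (oneBosonFock N (χ a)) := by
    simp only [hunit, mul_sub, Finset.sum_sub_distrib, mul_ite, mul_one, mul_zero,
      Finset.sum_ite_eq, Finset.mem_univ, if_true]
    congr 1
    rw [Matrix.trace]
    simp only [Matrix.diag_apply, h3, Finset.mul_sum]
    rw [Finset.sum_comm]
    exact Finset.sum_congr rfl fun a _ => Finset.sum_comm
  rw [Matrix.add_apply, Matrix.smul_apply, h3, h4]
  simp only [hin, mul_add, Finset.sum_add_distrib]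
  congr 1
  rw [groundState, Matrix.single_apply]
  by_cases hi : i = Sum.inl () <;> by_cases hj : j = Sum.inl () <;>
    simp [hi, hj, eq_comm]

/-- The map picked by choice is determined: it is prescribed on evolved density matrices, which span
because the channel of an invertible `V t₁` is onto. -/
theorem evolutionMap_eq (hω : Measurable ω) (hg : MemLp g 2 volume)
    (hU₀ : IsUnitaryGroup (freeHam HS ω) U₀) (hU : IsUnitaryGroup (fullHam HS ω g) U)
    (hV : IsPropagator HS (bathCorr ω g) V) {t₁ t₂ : ℝ} (ht₁ : 0 ≤ t₁) (ht : t₁ ≤ t₂)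
    (hu : IsUnit (V t₁)) :
    evolutionMap U₀ U t₁ t₂ = channel (extend (V t₂ * (V t₁)⁻¹)) := by
  have hdet : IsUnit (V t₁).det := (Matrix.isUnit_iff_isUnit_det _).1 hu
  have hR₁ := reducedState_eq hω hg hU₀ hU hV ht₁
  have hR₂ := reducedState_eq hω hg hU₀ hU hV (ht₁.trans ht)
  have hex : ∃ Φ, IsEvolutionMap U₀ U t₁ t₂ Φ :=
    ⟨channel (extend (V t₂ * (V t₁)⁻¹)), fun ρ _ _ => by
      rw [hR₁, hR₂, channel_channel, mul_assoc, Matrix.nonsing_inv_mul _ hdet, mul_one]⟩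
  rw [evolutionMap, dif_pos hex]
  have hlin : hex.choose ∘ₗ channel (extend (V t₁)) = channel (extend (V t₂)) :=
    linearMap_ext_density fun ρ hρ htr => by
      have := hex.choose_spec ρ hρ htr
      rw [hR₁, hR₂] at this
      exact this.symm
  refine LinearMap.ext fun ρ => ?_
  have h1 : channel (extend (V t₁)) (channel (extend (V t₁)⁻¹) ρ) = ρ := by
    rw [channel_channel, Matrix.mul_nonsing_inv _ hdet, extend_one, channel_one]
  conv_lhs => rw [← h1]
  rw [← LinearMap.comp_apply, hlin, channel_channel]

theorem corrM_eq (hω : Measurable ω) (hg : MemLp g 2 volume)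
    (hU₀ : IsUnitaryGroup (freeHam HS ω) U₀) (hU : IsUnitaryGroup (fullHam HS ω g) U)
    (hV : IsPropagator HS (bathCorr ω g) V) {t₁ t₂ : ℝ} (ht₁ : 0 ≤ t₁) (ht : t₁ ≤ t₂)
    (hu : IsUnit (V t₁)) (h₁ h₂ : Fin N → ℂ) :
    corrM U₀ U t₁ t₂ h₁ h₂ = star h₂ ⬝ᵥ ((V t₂ * (V t₁)⁻¹) *ᵥ h₁) := by
  rw [corrM, evolutionMap_eq hω hg hU₀ hU hV ht₁ ht hu,
    evolutionMap_eq hω hg hU₀ hU hV le_rfl ht₁ (by rw [hV.init]; exact isUnit_one),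
    channel_groundState, dipole_mul_groundState, channel_dipole, trace_dipole_conjTranspose_mul]

theorem hasTrace_corrOp (hω : Measurable ω) (hg : MemLp g 2 volume)
    (hU₀ : IsUnitaryGroup (freeHam HS ω) U₀) (hU : IsUnitaryGroup (fullHam HS ω g) U)
    (hV : IsPropagator HS (bathCorr ω g) V) {t₁ t₂ : ℝ} (ht : t₁ ≤ t₂) (h₁ h₂ : Fin N → ℂ) :
    HasTrace (corrOp U₀ U t₁ t₂ h₁ h₂) (star h₂ ⬝ᵥ (V (t₂ - t₁) *ᵥ h₁)) := by
  obtain ⟨φ, hφ⟩ := exists_intProp_sector hω hg hU₀ hU hV h₁ ht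
  rw [← inner_ket_tensor_dipole_sector h₂ (V (t₂ - t₁) *ᵥ h₁) φ]
  exact hasTrace_comp_conjBy_comp_conjBy tensor_groundState_vacuumProj
    (intProp_ket_vacuum hU₀ hU 0 t₁) (intProp_ket_vacuum hU₀ hU t₁ t₂)
    (tensor_dipole_ket_vacuum h₁) hφ

end Correlations

end RWA


end

theorem theorem3 {N : ℕ} (HS : Matrix (Fin N) (Fin N) ℂ) (hHS : HS.IsHermitian)
    (ω : ℝ → ℝ) (hω : Measurable ω) (g : ℝ → ℂ) (hg : MemLp g 2 volume)
    (U₀ U : ℝ → RWA.Total N ≃ₗᵢ[ℂ] RWA.Total N)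
    (hU₀ : RWA.IsUnitaryGroup (RWA.freeHam HS ω) U₀)
    (hU : RWA.IsUnitaryGroup (RWA.fullHam HS ω g) U)
    (V : ℝ → Matrix (Fin N) (Fin N) ℂ) (hV : RWA.IsPropagator HS (RWA.bathCorr ω g) V) :
    (∀ t₁ t₂ : ℝ, 0 ≤ t₁ → t₁ ≤ t₂ → IsUnit (V t₁) → ∀ h₁ h₂ : Fin N → ℂ,
      RWA.corrM U₀ U t₁ t₂ h₁ h₂ = star h₂ ⬝ᵥ ((V t₂ * (V t₁)⁻¹) *ᵥ h₁)) ∧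
    (∀ t₁ t₂ : ℝ, 0 ≤ t₁ → t₁ ≤ t₂ → ∀ h₁ h₂ : Fin N → ℂ,
      RWA.HasTrace (RWA.corrOp U₀ U t₁ t₂ h₁ h₂) (RWA.corr U₀ U t₁ t₂ h₁ h₂) ∧
      RWA.corr U₀ U t₁ t₂ h₁ h₂ = star h₂ ⬝ᵥ (V (t₂ - t₁) *ᵥ h₁)) ∧
    ((∀ t : ℝ, 0 ≤ t → IsUnit (V t)) →
      ((∀ t₁ t₂ : ℝ, 0 ≤ t₁ → t₁ ≤ t₂ → ∀ h₁ h₂ : Fin N → ℂ,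
          RWA.corr U₀ U t₁ t₂ h₁ h₂ = RWA.corrM U₀ U t₁ t₂ h₁ h₂) ↔
        ∀ s t : ℝ, 0 ≤ s → 0 ≤ t → V (s + t) = V s * V t)) := by
  have hM := fun {t₁ t₂ : ℝ} (h0 : 0 ≤ t₁) (h : t₁ ≤ t₂) (hu : IsUnit (V t₁)) =>
    RWA.corrM_eq hω hg hU₀ hU hV h0 h hu
  have hT := fun {t₁ t₂ : ℝ} (h : t₁ ≤ t₂) => RWA.hasTrace_corrOp hω hg hU₀ hU hV h
  have hC : ∀ {t₁ t₂ : ℝ}, t₁ ≤ t₂ → ∀ h₁ h₂ : Fin N → ℂ,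
      RWA.corr U₀ U t₁ t₂ h₁ h₂ = star h₂ ⬝ᵥ (V (t₂ - t₁) *ᵥ h₁) := fun h h₁ h₂ => (hT h h₁ h₂).tr_eq
  refine ⟨fun t₁ t₂ h0 h hu => hM h0 h hu, fun t₁ t₂ _ h h₁ h₂ => ⟨?_, hC h h₁ h₂⟩,
    fun hinv => ⟨fun hcorr s t hs ht => ?_, fun hsemi t₁ t₂ h0 h h₁ h₂ => ?_⟩⟩
  · rw [hC h]
    exact hT h h₁ h₂
  · have hst : t ≤ s + t := le_add_of_nonneg_left hs
    have hdet : IsUnit (V t).det := (Matrix.isUnit_iff_isUnit_det _).1 (hinv t ht)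
    have hVs : V s = V (s + t) * (V t)⁻¹ := by
      ext i j
      -- Basis vectors as dipoles extract the `(i, j)` entries; the times `t` and `s + t` make the
      -- elapsed time `s`.
      have := hcorr t (s + t) ht hst (Pi.single j 1) (Pi.single i 1)
      rw [hC hst, hM ht hst (hinv t ht), add_sub_cancel_right] at this
      simpa [← Pi.single_star] using this
    rw [hVs, mul_assoc, Matrix.nonsing_inv_mul _ hdet, mul_one]
  · have hdet : IsUnit (V t₁).det := (Matrix.isUnit_iff_isUnit_det _).1 (hinv t₁ h0)
    rw [hC h, hM h0 h (hinv t₁ h0)]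
    have := hsemi (t₂ - t₁) t₁ (sub_nonneg.2 h) h0
    rw [sub_add_cancel] at this
    rw [this, mul_assoc, Matrix.mul_nonsing_inv _ hdet, mul_one]
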